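/- **Setting.** Let $\mathcal C$ be a finite thin category whose objects are typed as entity, attribute or relationship objects; each relationship object $R$ has a nonempty set $\pi(R)$ of projection objects, with a morphism from $R$ to each of them. Let $G$ be a graph representation of $\mathcal C$: a directed graph on the objects of $\mathcal C$ whose arrows are morphisms generating $\mathcal C$ under composition. Let $F$ be a finite set of functional dependencies (FDs) between finite sets of objects of $\mathcal C$, with nonempty left-hand sides. For such a graph $G$, $FD(G)$ consists of $X\to Y$ for every arrow from $X$ to $Y$ and of $\pi(R)\to R$ for every relationship object $R$. Inference of FDs is by Armstrong's axioms. **First reduced representation.** The closure graph $(G,F)^+$ has as nodes the objects of $\mathcal C$ and, for each left-hand side $X$ of $F$ that is neither a single object nor equal to $\pi(R)$ for some relationship object $R$, a new relationship object with $\pi$-set $X$. It has an arrow from a node $X$ to an object $Y$ of $\mathcal C$ iff $X\to Y$ can be inferred from $FD(G)\cup F$. Fix $F_0\subseteq F$ (for example $F_0=\emptyset$ or $F_0=F$). A first reduced representation (1RR) $H$ is obtained by going through all arrows $f$ of $(G,F)^+$ in any order and deleting $f$ whenever the current graph $G'$ is equivalent to $G'-f$, that is, whenever every arrow of each of them can be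 inferred from the FDs of the other together with $F_0$. **DTD.** A DTD is $(L,T,P,R,r)$ with a finite set $L$ of tags, a finite set $T$ of attributes, a root $r\in L$, a rule $P_a$ for each tag $a$ that is $\#P$ (text) or a regular expression over $L\setminus\{r\}$, and $R(a)\subseteq T$. From $H$ one obtains $D$ as follows. The root is $\varepsilon$. Process the nodes $O$ of $H$ that have outgoing edges, in any order. For each of them append $O^+$ to $P_\varepsilon$, put $@ID$ into $R(O)$, start $P_O$ with the empty word, and then, for each outgoing neighbour $N$ of $O$, in any order, add $@N\_ID$ to $R(O)$ if $N$ has an outgoing edge, and otherwise append the tag $N$ to $P_O$, with $P_N=\#P$. (In a variant of the algorithm, neighbours $N$ that have already been processed are passed over; the theorem covers both variants.) **XML FDs.** A tree tuple of an XML tree conforming to $D$ assigns to each path of $D$ a vertex, a string, or no value, by choosing, starting from the root, for each chosen vertex one child of each tag that occurs among its children. A tree satisfies $S_1\to S_2$, for finite nonempty sets $S_1,S_2$ of paths of $D$, if any two tree tuples that agree, with values, on $S_1$ agree on $S_2$. $(D,\Sigma)$ implies $\varphi$ if every finite XML tree that conforms to $D$ and satisfies $\Sigma$ satisfies $\varphi$;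 $\varphi$ is trivial if $(D,\emptyset)$ implies it. For a node $O$ of $H$ write $\mathrm{val}_O(O)=\varepsilon.O.@ID$, and for an outgoing neighbour $Z\neq O$ of $O$ write $\mathrm{val}_O(Z)=\varepsilon.O.@Z\_ID$ if $Z$ has an outgoing edge and $\mathrm{val}_O(Z)=\varepsilon.O.Z.\#P$ otherwise. Let $\Sigma$ be the set of induced XML FDs, i.e. of those of the following FDs whose two sides are nonempty sets of paths of $D$: * $\varepsilon.O.@ID\to\varepsilon.O$ for every node $O$; * $\varepsilon.O\to\varepsilon.O.N$ and $\varepsilon.O\to\varepsilon.O.@N\_ID$ for every arrow from $O$ to $N$ in $H$; * $\mathrm{val}_O(X)\to\mathrm{val}_O(Y)$ for every FD $X\to Y$ that can be inferred from $FD(H)\cup F$ and every node $O$ such that $X\cup Y$ consists of $O$ and outgoing neighbours of $O$. **Theorem.** The output $D$ of the algorithm on a first reduced representation $H$ is a DTD, and $(D,\Sigma)$ is in the XML normal form of Arenas and Libkin: for every finite nonempty set $X$ of paths of $D$ and every nontrivial XML FD over $D$ implied by $(D,\Sigma)$ of the form $X\to p.@a$ (with $@a$ any attribute, in particular $@ID$)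 or $X\to p.\#P$, the FD $X\to p$ is also implied by $(D,\Sigma)$. -/

import Mathlib

open CategoryTheory

/-! ## Functional dependencies and Armstrong's axioms -/

/-- A functional dependency `lhs → rhs` between finite sets of attributes (objects). -/
structure FD (α : Type*) where
  lhs : Finset α
  rhs : Finset α

/-- Inference of functional dependencies from `D` by Armstrong's axioms: reflexivity,
augmentation and transitivity. `Infers D X Y` says that `X → Y` is inferred from `D`. -/
inductive Infers {α : Type*} [DecidableEq α] (D : Set (FD α)) : Finset α → Finset α → Prop
  | given {φ : FD α} : φ ∈ D → Infers D φ.lhs φ.rhs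
  | reflexivity {X Y : Finset α} : Y ⊆ X → Infers D X Y
  | augmentation {X Y : Finset α} (Z : Finset α) : Infers D X Y → Infers D (X ∪ Z) (Y ∪ Z)
  | transitivity {X Y Z : Finset α} : Infers D X Y → Infers D Y Z → Infers D X Z

/-! ## Schema categories and their graph representations -/

/-- The three types of objects of a database category. -/
inductive ObjectKind
  | entity
  | attribute
  | relationship

/-- A finite directed graph on typed objects. There is at most one arrow between two objects, so
that an arrow is a pair (source, target). `proj R` is the set of projection objects of a
relationship object `R`; it is a part of the type of `R` and stays the same when arrows are
removed. It is not used for other objects. -/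
structure SchemaGraph (α : Type*) where
  obj : Finset α
  arr : Finset (α × α)
  kind : α → ObjectKind
  proj : α → Finset α

/-- `G` is a graph representation of the finite thin schema category `C`: its nodes are the objects
of `C`, and its arrows are morphisms that generate `C` under composition. Each relationship object
has at least one projection object, and it has a projection morphism to each of them. -/
structure SchemaGraph.Represents {C : Type*} [SmallCategory C] [Fintype C]
    (G : SchemaGraph C) : Prop where
  thin : Quiver.IsThin C
  obj_eq : G.obj = Finset.univ
  hom_iff : ∀ X Y : C,
    Nonempty (X ⟶ Y) ↔ Relation.ReflTransGen (fun A B => (A, B) ∈ G.arr) X Y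
  proj_nonempty : ∀ R : C, G.kind R = ObjectKind.relationship → (G.proj R).Nonempty
  proj_hom : ∀ R : C, G.kind R = ObjectKind.relationship →
    ∀ A ∈ G.proj R, Nonempty (R ⟶ A)

namespace SchemaGraph

variable {α : Type*} [DecidableEq α]

/-- The functional dependencies of a graph: `X → Y` for every arrow from `X` to `Y`, and
`A₁, …, Aₙ → R` for every relationship object `R` with the projection objects `A₁, …, Aₙ`. The
dependency `R → A₁, …, Aₙ` is the one carried by the arrows that leave `R`. -/
def fds (G : SchemaGraph α) : Set (FD α) :=
  {φ | (∃ f ∈ G.arr, φ = ⟨{f.1}, {f.2}⟩) ∨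
       (∃ R ∈ G.obj, G.kind R = ObjectKind.relationship ∧ φ = ⟨G.proj R, {R}⟩)}

/-- `G` covers `G'` (given the dependencies `B`): every arrow of `G'` can be inferred from `G`
and `B`. -/
def Covers (B : Set (FD α)) (G G' : SchemaGraph α) : Prop :=
  ∀ f ∈ G'.arr, Infers (G.fds ∪ B) {f.1} {f.2}

/-- Equivalence of two graph representations (given the dependencies `B`). -/
def Equivalent (B : Set (FD α)) (G G' : SchemaGraph α) : Prop :=
  Covers B G G' ∧ Covers B G' G

/-- The graph `G - f`. -/
def removeArrow (G : SchemaGraph α) (f : α × α) : SchemaGraph α :=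
  { G with arr := G.arr.erase f }

open Classical in
/-- Remove the arrow `f` if the graph without it is equivalent to the graph. -/
noncomputable def reduceStep (B : Set (FD α)) (G : SchemaGraph α) (f : α × α) : SchemaGraph α :=
  if Equivalent B (G.removeArrow f) G then G.removeArrow f else G

/-- Go through the arrows in the order of the list and remove the redundant ones. -/
noncomputable def reduce (B : Set (FD α)) (G : SchemaGraph α) (arrows : List (α × α)) :
    SchemaGraph α :=
  arrows.foldl (reduceStep B) G

/-- `O` has an outgoing edge. -/
def HasOut (G : SchemaGraph α) (O : α) : Prop := ∃ f ∈ G.arr, f.1 = O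

instance (G : SchemaGraph α) (O : α) : Decidable (G.HasOut O) := by
  unfold HasOut; infer_instance

/-- The outgoing neighbours of `O`. -/
def outNbr (G : SchemaGraph α) (O : α) : Finset α :=
  (G.arr.filter fun f => f.1 = O).image Prod.snd

end SchemaGraph

/-! ## The relevant closure representation and the first reduced representation -/

/-- The objects of the closure: the objects of the category and new objects for left-hand sides. -/
inductive ClosureObj (C : Type*)
  | base (A : C)
  | lhs (X : Finset C)
  deriving DecidableEq

namespace ClosureObj

variable {C : Type*}

/-- The set of attributes for which an object of the closure stands. -/
def attrs : ClosureObj C → Finset C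
  | base A => {A}
  | lhs X => X

end ClosureObj

section Closure

variable {C : Type*} [DecidableEq C]

open Classical in
/-- The left-hand sides in `F` that are not yet in `G`. A single attribute is in `G` as that
object, and a set of attributes is in `G` if it is the set of projection objects of a relationship
object of `G`. -/
noncomputable def newLHS (G : SchemaGraph C) (F : Finset (FD C)) : Finset (Finset C) :=
  (F.image FD.lhs).filter fun X =>
    X.card ≠ 1 ∧ ¬ ∃ R ∈ G.obj, G.kind R = ObjectKind.relationship ∧ G.proj R = X

/-- The objects of the closure of `G` with `F`. -/
noncomputable def closureObjs (G : SchemaGraph C) (F : Finset (FD C)) :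
    Finset (ClosureObj C) :=
  G.obj.image ClosureObj.base ∪ (newLHS G F).image ClosureObj.lhs

open Classical in
/-- The relevant closure representation `(G, F)⁺`: for every `X` that is an object of `G` or a
left-hand side of `F`, and for every object `Y` of `G`, there is an arrow from `X` to `Y` if and
only if `Y` is in the attribute closure of `X` with respect to the dependencies of `G` and `F`.
A new object for a left-hand side is a relationship object, and its projection objects are the
attributes of this left-hand side. -/
noncomputable def closureGraph (G : SchemaGraph C) (F : Finset (FD C)) :
    SchemaGraph (ClosureObj C) where
  obj := closureObjs G F
  arr := (closureObjs G F ×ˢ G.obj.image ClosureObj.base).filter fun f =>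
    Infers (G.fds ∪ F) f.1.attrs f.2.attrs
  kind
    | .base A => G.kind A
    | .lhs _ => ObjectKind.relationship
  proj
    | .base A => (G.proj A).image ClosureObj.base
    | .lhs X => X.image ClosureObj.base

/-- Dependencies between objects of the category, as dependencies between objects of the closure. -/
def liftFDs (F : Finset (FD C)) : Set (FD (ClosureObj C)) :=
  {φ | ∃ ψ ∈ F, φ = ⟨ψ.lhs.image ClosureObj.base, ψ.rhs.image ClosureObj.base⟩}

/-- The first reduced representation of `G` with `F`: compute the closure `(G, F)⁺`, go through its
arrows in the order of the list `arrows`, and remove every arrow whose removal gives an equivalent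
graph, where the equivalence is taken given the dependencies `F₀`. -/
noncomputable def firstReduced (G : SchemaGraph C) (F F₀ : Finset (FD C))
    (arrows : List (ClosureObj C × ClosureObj C)) : SchemaGraph (ClosureObj C) :=
  (closureGraph G F).reduce (liftFDs F₀) arrows

end Closure

/-- The list `l` runs through the finite set `s`, each element once. -/
def Enumerates {α : Type*} (l : List α) (s : Finset α) : Prop :=
  l.Nodup ∧ ∀ x, x ∈ l ↔ x ∈ s

/-! ## DTDs, XML trees and XML functional dependencies -/

/-- An element type definition: `#PCDATA` or a regular expression over element types. -/
inductive Content (El : Type*)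
  | pcdata
  | regex (e : RegularExpression El)

/-- The symbols that occur in a regular expression. -/
def regexSymbols {El : Type*} : RegularExpression El → Set El
  | .zero => ∅
  | .epsilon => ∅
  | .char a => {a}
  | .plus e f => regexSymbols e ∪ regexSymbols f
  | .comp e f => regexSymbols e ∪ regexSymbols f
  | .star e => regexSymbols e

/-- The element types that occur in an element type definition. -/
def Content.symbols {El : Type*} : Content El → Set El
  | .pcdata => ∅
  | .regex e => regexSymbols e

/-- The data `(L, T, P, R, r)` of a DTD. -/
structure DTD (El At : Type*) where
  L : Finset El
  T : Finset At
  P : El → Content El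
  R : El → Finset At
  r : El

/-- The requirements on the data of a DTD: `P` maps `L` to element type definitions over `L - {r}`,
`R` maps `L` to subsets of `T`, and the root is in `L`. -/
structure DTD.IsDTD {El At : Type*} (D : DTD El At) : Prop where
  root_mem : D.r ∈ D.L
  content : ∀ a ∈ D.L, ∀ b ∈ (D.P a).symbols, b ∈ D.L ∧ b ≠ D.r
  attributes : ∀ a ∈ D.L, D.R a ⊆ D.T

/-- A path `w₁.….wₙ`, `w₁.….wₙ.@a` or `w₁.….wₙ.#P`. -/
inductive XPath (El At : Type*)
  | elem (w : List El)
  | attr (w : List El) (a : At)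
  | text (w : List El)
  deriving DecidableEq

namespace DTD

variable {El At : Type*} (D : DTD El At)

/-- `w₁.….wₙ` is a path of element types in `D`: it starts at the root, and every later element
type occurs in the definition of the one before. -/
def IsElemPath (w : List El) : Prop :=
  w.head? = some D.r ∧ List.IsChain (fun a b => b ∈ (D.P a).symbols) w

/-- The paths in `D`. -/
def IsPath : XPath El At → Prop
  | .elem w => D.IsElemPath w
  | .attr w a => D.IsElemPath w ∧ ∃ e, w.getLast? = some e ∧ a ∈ D.R e
  | .text w => D.IsElemPath w ∧ ∃ e, w.getLast? = some e ∧ D.P e = Content.pcdata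

end DTD

/-- A finite rooted ordered XML tree: every vertex has a label, either a string or a list of
children as content, and string values for some attributes. -/
structure XMLTree (El At : Type*) where
  V : Type
  finite : Finite V
  root : V
  lab : V → El
  ele : V → String ⊕ List V
  att : V → At → Option String
  children_nodup : ∀ v cs, ele v = Sum.inr cs → cs.Nodup
  root_not_child : ∀ v cs, ele v = Sum.inr cs → root ∉ cs
  parent_unique : ∀ v v' cs cs', ele v = Sum.inr cs → ele v' = Sum.inr cs' →
    ∀ u, u ∈ cs → u ∈ cs' → v = v'
  reachable : ∀ u, Relation.ReflTransGen (fun v v' => ∃ cs, ele v = Sum.inr cs ∧ v' ∈ cs) root u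

namespace XMLTree

variable {El At : Type*} (T : XMLTree El At)

/-- `u` is a child of `v`. -/
def Child (v u : T.V) : Prop := ∃ cs, T.ele v = Sum.inr cs ∧ u ∈ cs

/-- The tree conforms to the DTD `D`. -/
structure Conforms (D : DTD El At) : Prop where
  root_lab : T.lab T.root = D.r
  lab_mem : ∀ v, T.lab v ∈ D.L
  pcdata : ∀ v, D.P (T.lab v) = Content.pcdata → ∃ s, T.ele v = Sum.inl s
  regex : ∀ v e, D.P (T.lab v) = Content.regex e →
    ∃ cs, T.ele v = Sum.inr cs ∧ cs.map T.lab ∈ e.matches'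
  att_iff : ∀ v a, (T.att v a).isSome = true ↔ a ∈ D.R (T.lab v)

/-- `t` is a (maximal) tree tuple of the tree `T` over `D`. It gives a vertex, a string or no value
to each path in `D`. It goes to the root, and from a chosen vertex to one child for each
label for which there is a child, and it reads off the attributes and the texts of the chosen
vertices. -/
structure IsTreeTuple (D : DTD El At) (t : XPath El At → Option (T.V ⊕ String)) : Prop where
  support : ∀ p, ¬ D.IsPath p → t p = none
  root : t (.elem [D.r]) = some (Sum.inl T.root)
  elem_value : ∀ w a x, w ≠ [] → t (.elem (w ++ [a])) = some x →
    ∃ v u, t (.elem w) = some (Sum.inl v) ∧ x = Sum.inl u ∧ T.Child v u ∧ T.lab u = a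
  elem_maximal : ∀ w a v u, D.IsPath (.elem (w ++ [a])) → t (.elem w) = some (Sum.inl v) →
    T.Child v u → T.lab u = a → t (.elem (w ++ [a])) ≠ none
  attr_value : ∀ w a, D.IsPath (.attr w a) → ∀ s,
    t (.attr w a) = some s ↔
      ∃ v str, t (.elem w) = some (Sum.inl v) ∧ T.att v a = some str ∧ s = Sum.inr str
  text_value : ∀ w, D.IsPath (.text w) → ∀ s,
    t (.text w) = some s ↔
      ∃ v str, t (.elem w) = some (Sum.inl v) ∧ T.ele v = Sum.inl str ∧ s = Sum.inr str

end XMLTree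

/-- An XML functional dependency `lhs → rhs` between finite sets of paths. -/
structure XFD (El At : Type*) where
  lhs : Finset (XPath El At)
  rhs : Finset (XPath El At)

section XMLNormalForm

variable {El At : Type*}

/-- `φ` is a functional dependency over `D`: both sides are nonempty sets of paths in `D`. -/
structure XFD.IsOver (φ : XFD El At) (D : DTD El At) : Prop where
  lhs_nonempty : φ.lhs.Nonempty
  rhs_nonempty : φ.rhs.Nonempty
  lhs_paths : ∀ p ∈ φ.lhs, D.IsPath p
  rhs_paths : ∀ p ∈ φ.rhs, D.IsPath p

/-- The tree `T` satisfies `φ`: any two tree tuples that agree, with values, on the left-hand side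
agree on the right-hand side. -/
def XMLTree.Satisfies (T : XMLTree El At) (D : DTD El At) (φ : XFD El At) : Prop :=
  ∀ t₁ t₂, T.IsTreeTuple D t₁ → T.IsTreeTuple D t₂ →
    (∀ p ∈ φ.lhs, t₁ p = t₂ p ∧ t₁ p ≠ none) → ∀ q ∈ φ.rhs, t₁ q = t₂ q

/-- `(D, S)` implies `φ`: every tree that conforms to `D` and satisfies `S` also satisfies `φ`. -/
def DTD.Implies (D : DTD El At) (S : Set (XFD El At)) (φ : XFD El At) : Prop :=
  ∀ T : XMLTree El At, T.Conforms D → (∀ ψ ∈ S, T.Satisfies D ψ) → T.Satisfies D φ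

/-- `(D, S)` is in XML normal form: for every dependency `X → p.@a` or `X → p.#P` that `(D, S)`
implies and that is not trivial (not implied by `D` alone), `(D, S)` also implies `X → p`. -/
def DTD.InXMLNormalForm (D : DTD El At) (S : Set (XFD El At)) : Prop :=
  ∀ (X : Finset (XPath El At)) (w : List El) (q : XPath El At),
    ((∃ a, q = .attr w a) ∨ q = .text w) →
    XFD.IsOver ⟨X, {q}⟩ D →
    D.Implies S ⟨X, {q}⟩ → ¬ D.Implies ∅ ⟨X, {q}⟩ →
    D.Implies S ⟨X, {.elem w}⟩

end XMLNormalForm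

/-! ## From a graph representation to a DTD -/

/-- The tags: the root tag `ε` and the label of each object. -/
inductive Tag (α : Type*)
  | root
  | obj (O : α)
  deriving DecidableEq

/-- The attributes: `@ID`, and `@N_ID` for each object `N`. -/
inductive Att (α : Type*)
  | id
  | ref (N : α)
  deriving DecidableEq

/-- Append `f` to an element type definition. -/
def Content.append {El : Type*} : Content El → RegularExpression El → Content El
  | .pcdata, f => .regex f
  | .regex e, f => .regex (e * f)

namespace SchemaGraph

variable {α : Type*} [DecidableEq α]

/-- The DTD with the root tag only. A tag for which no rule is made is of type `#PCDATA`. -/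
def initDTD (α : Type*) [DecidableEq α] : DTD (Tag α) (Att α) where
  L := {.root}
  T := {.id}
  P := Function.update (fun _ => Content.pcdata) .root (.regex 1)
  R := fun _ => ∅
  r := .root

/-- Add the neighbour `N` to the tag of `O`: as an attribute `@N_ID` if `N` has an outgoing edge, as
a child otherwise. If `skip` is true, then neighbours in `done` are passed over. -/
def addNeighbour (G : SchemaGraph α) (skip : Bool) (done : Finset α) (O : α)
    (D : DTD (Tag α) (Att α)) (N : α) : DTD (Tag α) (Att α) :=
  if skip = true ∧ N ∈ done then D
  else if G.HasOut N then
    { D with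
      T := insert (.ref N) D.T
      R := Function.update D.R (.obj O) (insert (.ref N) (D.R (.obj O))) }
  else
    { D with
      P := Function.update D.P (.obj O) ((D.P (.obj O)).append (.char (.obj N)))
      L := insert (.obj N) D.L }

/-- Process the object `O` if it has an outgoing edge and is unprocessed: append `O⁺` to the rule of
the root, give `O` the attribute `@ID`, start the rule of `O` with the empty word, add the
neighbours of `O`, and mark `O` as processed. -/
def processObject (G : SchemaGraph α) (skip : Bool) (nbrs : α → List α)
    (s : DTD (Tag α) (Att α) × Finset α) (O : α) : DTD (Tag α) (Att α) × Finset α :=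
  if G.HasOut O ∧ O ∉ s.2 then
    let D : DTD (Tag α) (Att α) :=
      { L := insert (.obj O) s.1.L
        T := s.1.T
        P := Function.update
          (Function.update s.1.P .root
            ((s.1.P .root).append (.char (.obj O) * .star (.char (.obj O)))))
          (.obj O) (.regex 1)
        R := Function.update s.1.R (.obj O) {.id}
        r := s.1.r }
    ((nbrs O).foldl (G.addNeighbour skip s.2 O) D, insert O s.2)
  else s

/-- Map a graph representation to a DTD. The objects are processed in the order of the list `objs`,
and the neighbours of an object `O` in the order of the list `nbrs O`. -/
def toDTD (G : SchemaGraph α) (skip : Bool) (objs : List α) (nbrs : α → List α) :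
    DTD (Tag α) (Att α) :=
  (objs.foldl (G.processObject skip nbrs) (initDTD α, ∅)).1

/-- The path that holds the value of `Z` in the elements of `O`: `ε.O.@ID` for `Z = O`, `ε.O.@Z_ID`
for an object `Z` with an outgoing edge, and `ε.O.Z.#P` for an object `Z` without. -/
def valuePath (G : SchemaGraph α) (O Z : α) : XPath (Tag α) (Att α) :=
  if Z = O then .attr [.root, .obj O] .id
  else if G.HasOut Z then .attr [.root, .obj O] (.ref Z)
  else .text [.root, .obj O, .obj Z]

/-- The XML functional dependencies over `D` that are induced by the graph `G` and the
dependencies `B`: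
* `@ID` is a key: `ε.O.@ID → ε.O`;
* an arrow from `O` to `N` gives `ε.O → ε.O.N`, or `ε.O → ε.O.@N_ID` if `N` is
  represented by an attribute;
* every dependency `X → Y` that can be inferred from `G` and `B`, where `X` and `Y` consist of `O`
  and outgoing neighbours of `O`, gives the dependency between the paths in `O` that hold the values
  of `X` and of `Y`. -/
def inducedXFDs (G : SchemaGraph α) (B : Set (FD α)) (D : DTD (Tag α) (Att α)) :
    Set (XFD (Tag α) (Att α)) :=
  {φ | φ.IsOver D ∧
    ((∃ O, φ = ⟨{.attr [.root, .obj O] .id}, {.elem [.root, .obj O]}⟩) ∨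
     (∃ f ∈ G.arr, φ = ⟨{.elem [.root, .obj f.1]}, {.elem [.root, .obj f.1, .obj f.2]}⟩) ∨
     (∃ f ∈ G.arr, φ = ⟨{.elem [.root, .obj f.1]}, {.attr [.root, .obj f.1] (.ref f.2)}⟩) ∨
     (∃ (O : α) (X Y : Finset α), X ⊆ insert O (G.outNbr O) ∧ Y ⊆ insert O (G.outNbr O) ∧
        Infers (G.fds ∪ B) X Y ∧
        φ = ⟨X.image (G.valuePath O), Y.image (G.valuePath O)⟩))}

end SchemaGraph

/-! Let `q` hold the value of `A` in the elements of `O`, where `A` is `O` or an outgoing neighbour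
of `O`, and let `X → q` be implied and nontrivial, so `q ∉ X`. It suffices that `X` determines the
element `ε.O`: if `q` is a text, the induced FD `ε.O → ε.O.A` then gives the remaining step to the
child.

If `A = O`, then `q` is `ε.O.@ID`, which is a key. If `X` contains `ε.O`, its `@ID`, or one of its
children, the claim is immediate. Otherwise the only paths of `X` that depend on the choice of an
element of `O` are the values of a set `Z` of neighbours. If `Z → O` can be inferred, it induces an
XML FD from these values to `@ID`, hence `X → ε.O`. It remains to exclude the case that `Z → O`
cannot be inferred, by two arguments.

Semantic (`infers_of_implies`): take the tree with two elements per processed object. The two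
elements of `O` agree exactly on the attribute closure of `Z`; those of any other object agree on
nothing. Since this closure omits `O`, the identifiers differ and all induced FDs hold
(`tree_satisfies`). Two tree tuples that differ only in their element of `O` agree on `X`, so they
agree on `q`; that is, `Z → A` can be inferred.

Syntactic (`infers_source_of_infers_outNbr`): if `O` is outside the closure of `Z`, the arrow `O →
A` is never used in inferring `Z → A`. As `A ∉ Z`, the arrows from `O` to `Z` are different from it,
so `O → Z → A` infers it from the remaining graph. This contradicts irredundance
(`irredundant_reduce`).

Irredundance is relative to `F₀`, while the induced FDs use `F`. The two agree because the closure
graph infers every FD of `F` (`infers_closureGraph_of_mem`) and reduction preserves inference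
(`IsReduction.infers`). -/

/-! ### Inference by Armstrong's axioms -/

section Inference

variable {α : Type*} [DecidableEq α]

/-- A set of attributes that is closed under the given dependencies is closed under the inferred
ones. -/
theorem Infers.subset_of_closed {D : Set (FD α)} {S : Set α}
    (hS : ∀ φ ∈ D, (φ.lhs : Set α) ⊆ S → (φ.rhs : Set α) ⊆ S) {X Y : Finset α}
    (h : Infers D X Y) : (X : Set α) ⊆ S → (Y : Set α) ⊆ S := by
  induction h with
  | given hφ => exact hS _ hφ
  | reflexivity hYX => exact fun h => (Finset.coe_subset.2 hYX).trans h
  | augmentation Z _ ih =>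
    intro h
    rw [Finset.coe_union, Set.union_subset_iff] at h ⊢
    exact ⟨ih h.1, h.2⟩
  | transitivity _ _ ih₁ ih₂ => exact fun h => ih₂ (ih₁ h)

theorem Infers.of_forall_infers {D D' : Set (FD α)}
    (hD : ∀ φ ∈ D, Infers D' φ.lhs φ.rhs) {X Y : Finset α} (h : Infers D X Y) :
    Infers D' X Y := by
  induction h with
  | given hφ => exact hD _ hφ
  | reflexivity hYX => exact .reflexivity hYX
  | augmentation Z _ ih => exact .augmentation Z ih
  | transitivity _ _ ih₁ ih₂ => exact .transitivity ih₁ ih₂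

theorem Infers.mono {D D' : Set (FD α)} (hD : D ⊆ D') {X Y : Finset α} (h : Infers D X Y) :
    Infers D' X Y :=
  h.of_forall_infers fun _ hφ => .given (hD hφ)

theorem Infers.union {D : Set (FD α)} {X Y Z : Finset α} (hY : Infers D X Y)
    (hZ : Infers D X Z) : Infers D X (Y ∪ Z) := by
  have h₁ := hY.augmentation X
  have h₂ := hZ.augmentation Y
  rw [Finset.union_self] at h₁
  rw [Finset.union_comm X Y, Finset.union_comm Z Y] at h₂
  exact h₁.transitivity h₂

theorem Infers.of_forall_mem {D : Set (FD α)} {X Y : Finset α}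
    (h : ∀ y ∈ Y, Infers D X {y}) : Infers D X Y := by
  induction Y using Finset.induction_on with
  | empty => exact .reflexivity (Finset.empty_subset _)
  | insert a s _ ih =>
    rw [Finset.insert_eq]
    exact (h a (Finset.mem_insert_self _ _)).union
      (ih fun y hy => h y (Finset.mem_insert_of_mem hy))

theorem Infers.singleton_of_mem {D : Set (FD α)} {X Y : Finset α} (h : Infers D X Y) {y : α}
    (hy : y ∈ Y) : Infers D X {y} :=
  h.transitivity (.reflexivity (Finset.singleton_subset_iff.2 hy))

/-- The attribute closure of `X` is closed under inference. -/
theorem Infers.closure_closed {D : Set (FD α)} {X U V : Finset α} (h : Infers D U V)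
    (hU : ∀ u ∈ U, Infers D X {u}) : ∀ v ∈ V, Infers D X {v} :=
  fun _ hv => ((Infers.of_forall_mem hU).transitivity h).singleton_of_mem hv

/-- The empty set is closed under dependencies with nonempty left-hand sides. This is what makes an
inferred `Z → O` induce an XML FD, whose left-hand side has to be nonempty. -/
theorem Infers.lhs_nonempty {D : Set (FD α)} (hD : ∀ φ ∈ D, φ.lhs.Nonempty) {X Y : Finset α}
    (h : Infers D X Y) (hY : Y.Nonempty) : X.Nonempty := by
  by_contra hX
  rw [Finset.not_nonempty_iff_eq_empty] at hX
  subst hX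
  obtain ⟨y, hy⟩ := hY
  refine h.subset_of_closed (S := ∅) (fun φ hφ hsub => ?_) (by simp) hy
  obtain ⟨x, hx⟩ := hD φ hφ
  exact absurd (hsub hx) (Set.notMem_empty x)

end Inference

/-! ### Removal of redundant arrows -/

namespace SchemaGraph

section

variable {α : Type*}

theorem mem_fds_of_mem_arr {G : SchemaGraph α} {f : α × α} (hf : f ∈ G.arr) :
    (⟨{f.1}, {f.2}⟩ : FD α) ∈ G.fds :=
  .inl ⟨f, hf, rfl⟩

theorem fds_mono {G G' : SchemaGraph α} (hobj : G'.obj = G.obj) (hkind : G'.kind = G.kind)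
    (hproj : G'.proj = G.proj) (harr : G'.arr ⊆ G.arr) : G'.fds ⊆ G.fds := by
  rintro φ (⟨f, hf, rfl⟩ | ⟨R, hR, hk, rfl⟩)
  · exact .inl ⟨f, harr hf, rfl⟩
  · exact .inr ⟨R, hobj ▸ hR, hkind ▸ hk, by rw [hproj]⟩

end

variable {α : Type*} [DecidableEq α]

theorem infers_of_mem_arr {G : SchemaGraph α} (B : Set (FD α)) {f : α × α} (hf : f ∈ G.arr) :
    Infers (G.fds ∪ B) {f.1} {f.2} :=
  .given (φ := ⟨_, _⟩) (Or.inl (mem_fds_of_mem_arr hf))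

theorem removeArrow_fds_subset (G : SchemaGraph α) (f : α × α) :
    (G.removeArrow f).fds ⊆ G.fds :=
  fds_mono rfl rfl rfl (Finset.erase_subset _ _)

/-- `H` arises from `G` by the removal of arrows, and `G` can be recovered from `H` and `B`. -/
structure IsReduction (B : Set (FD α)) (G H : SchemaGraph α) : Prop where
  obj_eq : H.obj = G.obj
  kind_eq : H.kind = G.kind
  proj_eq : H.proj = G.proj
  arr_subset : H.arr ⊆ G.arr
  covers : Covers B H G

theorem IsReduction.refl (B : Set (FD α)) (G : SchemaGraph α) : IsReduction B G G :=
  ⟨rfl, rfl, rfl, subset_rfl, fun _ hf => infers_of_mem_arr B hf⟩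

theorem IsReduction.fds_subset {B : Set (FD α)} {G H : SchemaGraph α} (h : IsReduction B G H) :
    H.fds ⊆ G.fds :=
  fds_mono h.obj_eq h.kind_eq h.proj_eq h.arr_subset

/-- The deleted arrows are recovered by covering; the dependencies `π(R) → R` survive unchanged,
since projection sets do not depend on the arrows. -/
theorem IsReduction.infers {B : Set (FD α)} {G H : SchemaGraph α} (h : IsReduction B G H)
    {X Y : Finset α} (hXY : Infers (G.fds ∪ B) X Y) : Infers (H.fds ∪ B) X Y := by
  refine hXY.of_forall_infers ?_
  rintro φ ((⟨f, hf, rfl⟩ | ⟨R, hR, hk, rfl⟩) | hφ)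
  · exact h.covers f hf
  · exact .given (Or.inl (Or.inr ⟨R, h.obj_eq ▸ hR, h.kind_eq ▸ hk, by rw [h.proj_eq]⟩))
  · exact .given (Or.inr hφ)

theorem IsReduction.trans {B : Set (FD α)} {G G' H : SchemaGraph α} (h : IsReduction B G G')
    (h' : IsReduction B G' H) : IsReduction B G H :=
  ⟨h'.obj_eq.trans h.obj_eq, h'.kind_eq.trans h.kind_eq, h'.proj_eq.trans h.proj_eq,
    h'.arr_subset.trans h.arr_subset, fun f hf => h'.infers (h.covers f hf)⟩

theorem isReduction_reduceStep (B : Set (FD α)) (G : SchemaGraph α) (f : α × α) :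
    IsReduction B G (reduceStep B G f) := by
  unfold reduceStep
  split_ifs with h
  · exact ⟨rfl, rfl, rfl, Finset.erase_subset _ _, h.1⟩
  · exact .refl B G

theorem isReduction_reduce (B : Set (FD α)) (l : List (α × α)) (G : SchemaGraph α) :
    IsReduction B G (G.reduce B l) := by
  induction l generalizing G with
  | nil => exact .refl B G
  | cons f l ih => exact (isReduction_reduceStep B G f).trans (ih _)

/-- The arrow `f` cannot be inferred from the rest of `G` and `B`. -/
def Irredundant (B : Set (FD α)) (G : SchemaGraph α) (f : α × α) : Prop :=
  ¬ Infers ((G.removeArrow f).fds ∪ B) {f.1} {f.2}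

/-- A smaller graph infers less, so later deletions cannot make a retained arrow redundant. Hence
one pass through the arrows is enough. -/
theorem Irredundant.of_isReduction {B : Set (FD α)} {G H : SchemaGraph α} {f : α × α}
    (hf : Irredundant B G f) (h : IsReduction B G H) : Irredundant B H f := by
  refine fun hH => hf (hH.mono (Set.union_subset_union_left _ ?_))
  exact fds_mono h.obj_eq h.kind_eq h.proj_eq (Finset.erase_subset_erase _ h.arr_subset)

/-- All arrows other than `f` belong to both graphs, so equivalence can fail only at `f` itself. -/
theorem irredundant_reduceStep (B : Set (FD α)) (G : SchemaGraph α) (f : α × α)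
    (hf : f ∈ (reduceStep B G f).arr) : Irredundant B (reduceStep B G f) f := by
  unfold reduceStep at hf ⊢
  split_ifs at hf ⊢ with h
  · exact absurd hf (Finset.notMem_erase _ _)
  · refine fun hinf => h ⟨fun g hg => ?_, fun g hg => ?_⟩
    · by_cases hgf : g = f
      · exact hgf ▸ hinf
      · exact infers_of_mem_arr B (Finset.mem_erase.2 ⟨hgf, hg⟩)
    · exact infers_of_mem_arr B (Finset.mem_of_mem_erase hg)

theorem irredundant_reduce (B : Set (FD α)) (l : List (α × α)) (G : SchemaGraph α)
    {f : α × α} (hl : f ∈ l) (hf : f ∈ (G.reduce B l).arr) : Irredundant B (G.reduce B l) f := by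
  induction l generalizing G with
  | nil => simp at hl
  | cons g l ih =>
    rcases List.mem_cons.1 hl with rfl | hl
    · have hred := isReduction_reduce B l (reduceStep B G f)
      exact (irredundant_reduceStep B G f (hred.arr_subset hf)).of_isReduction hred
    · exact ih _ hl hf

/-- A loop follows by reflexivity, so none survives the reduction. The value of a neighbour of `O`
is therefore never confused with `@ID` in `valuePath`. -/
theorem Irredundant.fst_ne_snd {B : Set (FD α)} {G : SchemaGraph α} {f : α × α}
    (hf : Irredundant B G f) : f.1 ≠ f.2 :=
  fun h => hf (.reflexivity (by rw [h]))

theorem mem_outNbr {G : SchemaGraph α} {O N : α} : N ∈ G.outNbr O ↔ (O, N) ∈ G.arr := by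
  simp [outNbr]

/-- In a graph without redundant arrows, a set of neighbours of `O` that determines another
neighbour of `O` determines `O`. -/
theorem infers_source_of_infers_outNbr {H : SchemaGraph α} {B₀ B : Set (FD α)} (hB₀ : B₀ ⊆ B)
    (hB : ∀ φ ∈ B, Infers (H.fds ∪ B₀) φ.lhs φ.rhs)
    (hH : ∀ f ∈ H.arr, Irredundant B₀ H f) {O A : α} {Z : Finset α} (hZ : Z ⊆ H.outNbr O)
    (hA : A ∈ H.outNbr O) (hAZ : A ∉ Z) (h : Infers (H.fds ∪ B) Z {A}) :
    Infers (H.fds ∪ B) Z {O} := by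
  by_contra hO
  rw [mem_outNbr] at hA
  refine hH _ hA ?_
  have hsub : (H.removeArrow (O, A)).fds ∪ B₀ ⊆ H.fds ∪ B :=
    Set.union_subset_union (H.removeArrow_fds_subset _) hB₀
  -- Pass to the background `B₀`, for which irredundance is known.
  have h₀ : Infers (H.fds ∪ B₀) Z {A} := by
    refine h.of_forall_infers ?_
    rintro φ (hφ | hφ)
    · exact .given (Or.inl hφ)
    · exact hB φ hφ
  have hZA : Infers ((H.removeArrow (O, A)).fds ∪ B₀) Z {A} := by
    -- The closure of `Z` in the graph without the arrow is closed also under the full graph: the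
    -- one missing dependency, `O → A`, could fire only if `O` were in that closure, contrary to
    -- `hO`.
    refine h₀.subset_of_closed (S := {x | Infers ((H.removeArrow (O, A)).fds ∪ B₀) Z {x}})
      (fun φ hφ hl => ?_) (fun x hx => .reflexivity (Finset.singleton_subset_iff.2 hx))
      (Finset.mem_coe.2 (Finset.mem_singleton_self A))
    by_cases hφ' : φ ∈ (H.removeArrow (O, A)).fds ∪ B₀
    · exact Infers.closure_closed (.given hφ') hl
    · rcases hφ with (⟨f, hf, rfl⟩ | hφ) | hφ
      · have hfO : f = (O, A) := by
          by_contra hne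
          exact hφ' (Or.inl (mem_fds_of_mem_arr (Finset.mem_erase.2 ⟨hne, hf⟩)))
        subst hfO
        exact absurd ((hl (Finset.mem_coe.2 (Finset.mem_singleton_self O))).mono hsub) hO
      · exact absurd (Or.inl (Or.inr hφ)) hφ'
      · exact absurd (Or.inr hφ) hφ'
  -- Compose `O → Z` with `Z → A`; the arrows into `Z` are still present because `A ∉ Z`.
  refine Infers.transitivity (Infers.of_forall_mem fun z hz => ?_) hZA
  refine infers_of_mem_arr B₀ (f := (O, z)) (Finset.mem_erase.2 ⟨?_, ?_⟩)
  · rintro h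
    exact hAZ ((Prod.mk.inj h).2 ▸ hz)
  · exact mem_outNbr.1 (hZ hz)

end SchemaGraph

/-! ### Dependencies of the closure graph -/

section ClosureReduction

variable {C : Type*} [DecidableEq C]

theorem liftFDs_mono {F₀ F : Finset (FD C)} (h : F₀ ⊆ F) : liftFDs F₀ ⊆ liftFDs F :=
  fun _ ⟨ψ, hψ, hφ⟩ => ⟨ψ, h hψ, hφ⟩

theorem infers_of_hom [SmallCategory C] [Fintype C] {G : SchemaGraph C} (hG : G.Represents)
    {X Y : C} (h : Nonempty (X ⟶ Y)) : Infers G.fds {X} {Y} := by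
  induction (hG.hom_iff X Y).1 h using Relation.ReflTransGen.head_induction_on with
  | refl => exact .reflexivity subset_rfl
  | head hac hcb ih =>
    exact (Infers.given (SchemaGraph.mem_fds_of_mem_arr hac)).transitivity
      (ih ((hG.hom_iff _ _).2 hcb))

theorem mem_newLHS {G : SchemaGraph C} {F : Finset (FD C)} {X : Finset C} :
    X ∈ newLHS G F ↔ X ∈ F.image FD.lhs ∧ X.card ≠ 1 ∧
      ¬ ∃ R ∈ G.obj, G.kind R = ObjectKind.relationship ∧ G.proj R = X := by
  simp only [newLHS, Finset.mem_filter]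

theorem mem_closureObjs_lhs {G : SchemaGraph C} {F : Finset (FD C)} {X : Finset C} :
    ClosureObj.lhs X ∈ closureObjs G F ↔ X ∈ newLHS G F := by
  simp [closureObjs]

theorem fst_mem_closureGraph_obj {G : SchemaGraph C} {F : Finset (FD C)}
    {f : ClosureObj C × ClosureObj C} (hf : f ∈ (closureGraph G F).arr) :
    f.1 ∈ (closureGraph G F).obj := by
  simp only [closureGraph, Finset.mem_filter, Finset.mem_product] at hf
  exact hf.1.1

theorem mem_closureGraph_arr [SmallCategory C] [Fintype C] {G : SchemaGraph C}
    (hG : G.Represents) {F : Finset (FD C)} {O : ClosureObj C} {Y : C} :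
    (O, .base Y) ∈ (closureGraph G F).arr ↔
      O ∈ closureObjs G F ∧ Infers (G.fds ∪ F) O.attrs {Y} := by
  simp only [closureGraph, Finset.mem_filter, Finset.mem_product, hG.obj_eq,
    Finset.mem_image_of_mem, Finset.mem_univ, and_true]
  rfl

theorem mem_closureObjs_base [SmallCategory C] [Fintype C] {G : SchemaGraph C}
    (hG : G.Represents) {F : Finset (FD C)} (A : C) : .base A ∈ closureObjs G F := by
  simp [closureObjs, hG.obj_eq]

/-- Every left-hand side of `F` is represented by a node of the closure that it determines: the
object itself, a relationship object with this projection set, or the new object. From that node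
there are arrows to everything the left-hand side determines. -/
theorem infers_closureGraph_of_mem [SmallCategory C] [Fintype C] {G : SchemaGraph C}
    (hG : G.Represents) {F : Finset (FD C)} {φ : FD (ClosureObj C)}
    (hφ : φ ∈ liftFDs F) :
    Infers (closureGraph G F).fds φ.lhs φ.rhs := by
  obtain ⟨ψ, hψ, rfl⟩ := hφ
  refine Infers.of_forall_mem fun y hy => ?_
  obtain ⟨Y, hY, rfl⟩ := Finset.mem_image.1 hy
  have hψY : Infers (G.fds ∪ F) ψ.lhs {Y} :=
    (Infers.given (φ := ψ) (Or.inr hψ)).singleton_of_mem hY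
  by_cases hcard : ψ.lhs.card = 1
  · obtain ⟨A, hA⟩ := Finset.card_eq_one.1 hcard
    rw [hA] at hψY
    have harr : (.base A, .base Y) ∈ (closureGraph G F).arr :=
      (mem_closureGraph_arr hG).2 ⟨mem_closureObjs_base hG A, hψY⟩
    simpa [hA] using Infers.given (SchemaGraph.mem_fds_of_mem_arr harr)
  by_cases hproj : ∃ R ∈ G.obj, G.kind R = ObjectKind.relationship ∧ G.proj R = ψ.lhs
  · obtain ⟨R, -, hk, hR⟩ := hproj
    -- A projection morphism need not be an arrow of `G`, but it is a composite of arrows.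
    have hRX : Infers (G.fds ∪ F) {R} ψ.lhs :=
      Infers.of_forall_mem fun A hA =>
        (infers_of_hom hG (hG.proj_hom R hk A (hR ▸ hA))).mono Set.subset_union_left
    have harr : (.base R, .base Y) ∈ (closureGraph G F).arr :=
      (mem_closureGraph_arr hG).2 ⟨mem_closureObjs_base hG R, hRX.transitivity hψY⟩
    have hXR : Infers (closureGraph G F).fds (ψ.lhs.image .base) {.base R} :=
      .given (φ := ⟨_, _⟩) (.inr ⟨.base R, mem_closureObjs_base hG R, hk, by
        rw [← hR]; rfl⟩)
    exact hXR.transitivity (.given (SchemaGraph.mem_fds_of_mem_arr harr))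
  · have hnew : ψ.lhs ∈ newLHS G F :=
      mem_newLHS.2 ⟨Finset.mem_image_of_mem _ hψ, hcard, hproj⟩
    have hobj := mem_closureObjs_lhs.2 hnew
    have harr : (.lhs ψ.lhs, .base Y) ∈ (closureGraph G F).arr :=
      (mem_closureGraph_arr hG).2 ⟨hobj, hψY⟩
    have hXR : Infers (closureGraph G F).fds (ψ.lhs.image .base) {.lhs ψ.lhs} :=
      .given (φ := ⟨_, _⟩) (.inr ⟨.lhs ψ.lhs, hobj, rfl, rfl⟩)
    exact hXR.transitivity (.given (SchemaGraph.mem_fds_of_mem_arr harr))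

theorem closureGraph_fds_lhs_nonempty [SmallCategory C] [Fintype C] {G : SchemaGraph C}
    (hG : G.Represents) {F : Finset (FD C)} (hF : ∀ φ ∈ F, φ.lhs.Nonempty) :
    ∀ φ ∈ (closureGraph G F).fds ∪ liftFDs F, φ.lhs.Nonempty := by
  rintro φ ((⟨f, -, rfl⟩ | ⟨R, hR, hk, rfl⟩) | ⟨ψ, hψ, rfl⟩)
  · exact Finset.singleton_nonempty _
  · cases R with
    | base R => exact (hG.proj_nonempty R hk).image _
    | lhs X =>
      obtain ⟨ψ, hψ, rfl⟩ := Finset.mem_image.1 (mem_newLHS.1 (mem_closureObjs_lhs.1 hR)).1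
      exact (hF ψ hψ).image _
  · exact (hF ψ hψ).image _

end ClosureReduction

/-! ### Symbols and words of iterated products -/

section RegexFold

variable {α El : Type*}

theorem mem_regexSymbols_foldl {f : α → RegularExpression El} {b : El} (l : List α)
    (e : RegularExpression El) :
    b ∈ regexSymbols (l.foldl (fun e a => e * f a) e) ↔
      b ∈ regexSymbols e ∨ ∃ a ∈ l, b ∈ regexSymbols (f a) := by
  induction l generalizing e with
  | nil => simp
  | cons a l ih =>
    have h : regexSymbols (e * f a) = regexSymbols e ∪ regexSymbols (f a) := rfl
    simp [ih, h, or_assoc]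

theorem mem_matches_foldl {f : α → RegularExpression El} {g : α → List El} (l : List α)
    (hg : ∀ a ∈ l, g a ∈ (f a).matches') (e : RegularExpression El) {w : List El}
    (hw : w ∈ e.matches') :
    w ++ l.flatMap g ∈ (l.foldl (fun e a => e * f a) e).matches' := by
  induction l generalizing e w with
  | nil => simpa using hw
  | cons a l ih =>
    rw [List.flatMap_cons, ← List.append_assoc]
    refine ih (fun b hb => hg b (List.mem_cons_of_mem _ hb)) _ ?_
    rw [RegularExpression.matches'_mul]
    exact Language.append_mem_mul hw (hg a List.mem_cons_self)

theorem Content.foldl_append (f : α → RegularExpression El) (l : List α)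
    (e : RegularExpression El) :
    l.foldl (fun c a => Content.append c (f a)) (.regex e) =
      .regex (l.foldl (fun e a => e * f a) e) := by
  induction l generalizing e with
  | nil => rfl
  | cons a l ih => exact ih _

end RegexFold

/-! ### Output and paths of the DTD algorithm -/

namespace SchemaGraph

variable {α : Type*} [DecidableEq α]

/-- The objects of a list that have no outgoing edge. -/
def leaves (G : SchemaGraph α) (l : List α) : List α := l.filter fun N => ¬ G.HasOut N

theorem mem_leaves {G : SchemaGraph α} {l : List α} {N : α} :
    N ∈ G.leaves l ↔ N ∈ l ∧ ¬ G.HasOut N := by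
  simp [leaves]

/-- `D'` is `D` with the neighbours `ns` added to the tag of `O`. -/
structure AddsNeighbours (G : SchemaGraph α) (O : α) (ns : List α)
    (D D' : DTD (Tag α) (Att α)) : Prop where
  r_eq : D'.r = D.r
  mem_L : ∀ t, t ∈ D'.L ↔ t ∈ D.L ∨ ∃ N ∈ G.leaves ns, t = .obj N
  mem_T : ∀ a, a ∈ D'.T ↔ a ∈ D.T ∨ ∃ N ∈ ns, G.HasOut N ∧ a = .ref N
  P_obj : D'.P (.obj O) =
    (G.leaves ns).foldl (fun c N => c.append (.char (.obj N))) (D.P (.obj O))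
  P_other : ∀ t ≠ .obj O, D'.P t = D.P t
  R_obj : ∀ a, a ∈ D'.R (.obj O) ↔ a ∈ D.R (.obj O) ∨ ∃ N ∈ ns, G.HasOut N ∧ a = .ref N
  R_other : ∀ t ≠ .obj O, D'.R t = D.R t

/-- The set `done` is fixed while the neighbours of one object are added, so passing over processed
ones amounts to filtering the list beforehand. This treats both variants at once. -/
theorem addsNeighbours_foldl (G : SchemaGraph α) (skip : Bool) (done : Finset α) (O : α)
    (l : List α) (D : DTD (Tag α) (Att α)) :
    G.AddsNeighbours O (l.filter fun N => ¬ (skip = true ∧ N ∈ done)) D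
      (l.foldl (G.addNeighbour skip done O) D) := by
  induction l generalizing D with
  | nil => constructor <;> simp [leaves]
  | cons N l ih =>
    have h := ih (G.addNeighbour skip done O D N)
    rw [List.foldl_cons]
    by_cases hs : skip = true ∧ N ∈ done
    · have hD : G.addNeighbour skip done O D N = D := if_pos hs
      rw [List.filter_cons_of_neg (by simpa using hs)]
      rw [hD] at h ⊢
      exact h
    · rw [List.filter_cons_of_pos (by exact decide_eq_true hs)]
      by_cases ho : G.HasOut N
      · have hD : G.addNeighbour skip done O D N = { D with
            T := insert (.ref N) D.T
            R := Function.update D.R (.obj O) (insert (.ref N) (D.R (.obj O))) } :=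
          (if_neg hs).trans (if_pos ho)
        rw [hD] at h ⊢
        have hl : ∀ ns, G.leaves (N :: ns) = G.leaves ns := fun ns =>
          List.filter_cons_of_neg (by simpa using ho)
        constructor
        · exact h.r_eq
        · rw [hl]; exact h.mem_L
        · intro a
          rw [h.mem_T]
          simp only [Finset.mem_insert, List.mem_cons, exists_eq_or_imp, ho, true_and]
          tauto
        · rw [hl]; exact h.P_obj
        · exact h.P_other
        · intro a
          rw [h.R_obj]
          simp only [Function.update_self, Finset.mem_insert, List.mem_cons, exists_eq_or_imp,
            ho, true_and]
          tauto
        · intro t ht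
          rw [h.R_other t ht]
          exact Function.update_of_ne ht _ _
      · have hD : G.addNeighbour skip done O D N = { D with
            P := Function.update D.P (.obj O) ((D.P (.obj O)).append (.char (.obj N)))
            L := insert (.obj N) D.L } :=
          (if_neg hs).trans (if_neg ho)
        rw [hD] at h ⊢
        have hl : ∀ ns, G.leaves (N :: ns) = N :: G.leaves ns := fun ns =>
          List.filter_cons_of_pos (by simpa using ho)
        constructor
        · exact h.r_eq
        · intro t
          rw [h.mem_L, hl]
          simp only [Finset.mem_insert, List.mem_cons, exists_eq_or_imp]
          tauto
        · intro a
          rw [h.mem_T]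
          simp only [List.mem_cons, exists_eq_or_imp, ho, false_and, false_or]
        · rw [h.P_obj, hl, List.foldl_cons]
          simp only [Function.update_self]
        · intro t ht
          rw [h.P_other t ht]
          exact Function.update_of_ne ht _ _
        · intro a
          rw [h.R_obj]
          simp only [List.mem_cons, exists_eq_or_imp, ho, false_and, false_or]
        · exact h.R_other

/-- The DTD after the objects `os` have been processed, with the neighbours `kept O` of `O`. -/
structure IsOutput (G : SchemaGraph α) (nbrs : α → List α) (os : List α) (kept : α → List α)
    (D : DTD (Tag α) (Att α)) : Prop where
  nodup : os.Nodup
  hasOut : ∀ O ∈ os, G.HasOut O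
  kept_sublist : ∀ O ∈ os, (kept O).Sublist (nbrs O)
  r_eq : D.r = .root
  mem_L : ∀ t, t ∈ D.L ↔ t = .root ∨ ∃ O ∈ os, t = .obj O ∨ ∃ N ∈ G.leaves (kept O), t = .obj N
  id_mem_T : .id ∈ D.T
  ref_mem_T : ∀ O ∈ os, ∀ N ∈ kept O, G.HasOut N → .ref N ∈ D.T
  P_root : D.P .root = .regex
    (os.foldl (fun e O => e * (.char (.obj O) * .star (.char (.obj O)))) 1)
  P_obj : ∀ O ∈ os, D.P (.obj O) = .regex
    ((G.leaves (kept O)).foldl (fun e N => e * .char (.obj N)) 1)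
  P_other : ∀ O ∉ os, D.P (.obj O) = .pcdata
  R_root : D.R .root = ∅
  R_obj : ∀ O ∈ os, ∀ a, a ∈ D.R (.obj O) ↔ a = .id ∨ ∃ N ∈ kept O, G.HasOut N ∧ a = .ref N
  R_other : ∀ O ∉ os, D.R (.obj O) = ∅

theorem isOutput_initDTD (G : SchemaGraph α) (nbrs : α → List α) :
    G.IsOutput nbrs [] (fun _ => []) (initDTD α) := by
  constructor <;> simp [initDTD]

theorem IsOutput.processObject {G : SchemaGraph α} {nbrs : α → List α} {os : List α}
    {kept : α → List α} {s : DTD (Tag α) (Att α) × Finset α} (h : G.IsOutput nbrs os kept s.1)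
    (hs : ∀ O, O ∈ s.2 ↔ O ∈ os) (skip : Bool) {O : α} (hO : G.HasOut O) (hOs : O ∉ os) :
    G.IsOutput nbrs (os ++ [O])
      (Function.update kept O ((nbrs O).filter fun N => ¬ (skip = true ∧ N ∈ s.2)))
      (G.processObject skip nbrs s O).1 ∧
    ∀ N, N ∈ (G.processObject skip nbrs s O).2 ↔ N ∈ os ++ [O] := by
  have hcond : G.HasOut O ∧ O ∉ s.2 := ⟨hO, fun h' => hOs ((hs O).1 h')⟩
  unfold SchemaGraph.processObject
  rw [if_pos hcond]
  set ns := (nbrs O).filter fun N => ¬ (skip = true ∧ N ∈ s.2) with hns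
  refine ⟨?_, by simp [hs, or_comm]⟩
  have hA := G.addsNeighbours_foldl skip s.2 O (nbrs O)
    { L := insert (.obj O) s.1.L
      T := s.1.T
      P := Function.update
        (Function.update s.1.P .root
          ((s.1.P .root).append (.char (.obj O) * .star (.char (.obj O)))))
        (.obj O) (.regex 1)
      R := Function.update s.1.R (.obj O) {.id}
      r := s.1.r }
  rw [← hns] at hA
  have hkept : ∀ O' ∈ os, Function.update kept O ns O' = kept O' := fun O' hO' =>
    Function.update_of_ne (fun h' : O' = O => hOs (h' ▸ hO')) _ _
  have hne : ∀ O' ≠ O, (Tag.obj O' : Tag α) ≠ .obj O := fun O' h' h'' =>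
    h' (Tag.obj.inj h'')
  constructor
  · exact List.nodup_append.2 ⟨h.nodup, List.nodup_singleton O, by
      rintro a ha b hb rfl
      exact hOs (List.mem_singleton.1 hb ▸ ha)⟩
  · simpa [or_imp, forall_and, hO] using h.hasOut
  · intro O' hO'
    rcases List.mem_append.1 hO' with hO' | hO'
    · rw [hkept O' hO']; exact h.kept_sublist O' hO'
    · rw [List.mem_singleton.1 hO', Function.update_self]
      exact List.filter_sublist
  · exact hA.r_eq.trans h.r_eq
  · intro t
    rw [hA.mem_L]
    simp only [Finset.mem_insert, h.mem_L, List.mem_append, List.mem_singleton]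
    constructor
    · rintro ((rfl | rfl | ⟨O', hO', h'⟩) | h')
      · exact .inr ⟨O, .inr rfl, .inl rfl⟩
      · exact .inl rfl
      · exact .inr ⟨O', .inl hO', by rwa [hkept O' hO']⟩
      · exact .inr ⟨O, .inr rfl, .inr (by rwa [Function.update_self])⟩
    · rintro (rfl | ⟨O', hO' | rfl, h'⟩)
      · exact .inl (.inr (.inl rfl))
      · rw [hkept O' hO'] at h'
        exact .inl (.inr (.inr ⟨O', hO', h'⟩))
      · rw [Function.update_self] at h'
        exact h'.imp (fun h' => .inl h') id
  · exact (hA.mem_T _).2 (.inl h.id_mem_T)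
  · intro O' hO' N hN hout
    rw [hA.mem_T]
    rcases List.mem_append.1 hO' with hO' | hO'
    · rw [hkept O' hO'] at hN
      exact .inl (h.ref_mem_T O' hO' N hN hout)
    · rw [List.mem_singleton.1 hO', Function.update_self] at hN
      exact .inr ⟨N, hN, hout, rfl⟩
  · rw [hA.P_other _ (by simp)]
    simp [h.P_root, Content.append]
  · intro O' hO'
    rcases List.mem_append.1 hO' with hO' | hO'
    · have hO'O : O' ≠ O := fun h' => hOs (h' ▸ hO')
      rw [hA.P_other _ (hne O' hO'O), hkept O' hO', ← h.P_obj O' hO']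
      simp [hO'O]
    · rw [List.mem_singleton.1 hO', hA.P_obj, Function.update_self, ← Content.foldl_append]
      simp only [Function.update_self]
  · intro O' hO'
    simp only [List.mem_append, List.mem_singleton, not_or] at hO'
    rw [hA.P_other _ (hne O' hO'.2), ← h.P_other O' hO'.1]
    simp [hO'.2]
  · rw [hA.R_other _ (by simp), ← h.R_root]
    simp
  · intro O' hO' a
    rcases List.mem_append.1 hO' with hO' | hO'
    · have hO'O : O' ≠ O := fun h' => hOs (h' ▸ hO')
      rw [hA.R_other _ (hne O' hO'O), hkept O' hO', ← h.R_obj O' hO']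
      simp [hO'O]
    · rw [List.mem_singleton.1 hO', hA.R_obj, Function.update_self]
      simp only [Function.update_self, Finset.mem_singleton]
  · intro O' hO'
    simp only [List.mem_append, List.mem_singleton, not_or] at hO'
    rw [hA.R_other _ (hne O' hO'.2), ← h.R_other O' hO'.1]
    simp [hO'.2]

theorem exists_isOutput_foldl (G : SchemaGraph α) (skip : Bool) (nbrs : α → List α)
    (objs os : List α) (kept : α → List α) (s : DTD (Tag α) (Att α) × Finset α)
    (h : G.IsOutput nbrs os kept s.1) (hs : ∀ O, O ∈ s.2 ↔ O ∈ os) :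
    ∃ os' kept', G.IsOutput nbrs os' kept' (objs.foldl (G.processObject skip nbrs) s).1 := by
  induction objs generalizing os kept s with
  | nil => exact ⟨os, kept, h⟩
  | cons O objs ih =>
    rw [List.foldl_cons]
    by_cases hO : G.HasOut O ∧ O ∉ os
    · obtain ⟨h', hs'⟩ := h.processObject hs skip hO.1 hO.2
      exact ih _ _ _ h' hs'
    · have hid : G.processObject skip nbrs s O = s := if_neg (by rwa [hs])
      rw [hid]
      exact ih os kept s h hs

/-- Processing order and variant enter the rest of the argument only through the lists `os` and
`kept`. -/
theorem exists_isOutput_toDTD (G : SchemaGraph α) (skip : Bool) (objs : List α)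
    (nbrs : α → List α) :
    ∃ os kept, G.IsOutput nbrs os kept (G.toDTD skip objs nbrs) :=
  G.exists_isOutput_foldl skip nbrs objs [] (fun _ => []) (initDTD α, ∅)
    (G.isOutput_initDTD nbrs) (by simp)

namespace IsOutput

variable {G : SchemaGraph α} {nbrs : α → List α} {os : List α} {kept : α → List α}
  {D : DTD (Tag α) (Att α)}

theorem mem_symbols_root (h : G.IsOutput nbrs os kept D) {t : Tag α} :
    t ∈ (D.P .root).symbols ↔ ∃ O ∈ os, t = .obj O := by
  rw [h.P_root]
  simp only [Content.symbols]
  rw [mem_regexSymbols_foldl]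
  constructor
  · rintro (h' | ⟨O, hO, h' | h'⟩)
    · exact h'.elim
    · exact ⟨O, hO, h'⟩
    · exact ⟨O, hO, h'⟩
  · rintro ⟨O, hO, rfl⟩
    exact .inr ⟨O, hO, .inl rfl⟩

theorem mem_symbols_obj (h : G.IsOutput nbrs os kept D) {O : α} {t : Tag α} :
    t ∈ (D.P (.obj O)).symbols ↔ O ∈ os ∧ ∃ N ∈ G.leaves (kept O), t = .obj N := by
  by_cases hO : O ∈ os
  · rw [h.P_obj O hO]
    simp only [Content.symbols]
    rw [mem_regexSymbols_foldl]
    constructor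
    · rintro (h' | ⟨N, hN, h'⟩)
      · exact h'.elim
      · exact ⟨hO, N, hN, h'⟩
    · rintro ⟨-, N, hN, rfl⟩
      exact .inr ⟨N, hN, rfl⟩
  · rw [h.P_other O hO]
    simp [Content.symbols, hO]

/-- This bounds the paths: a leaf tag is never processed, so it keeps its text rule, has no
attributes and ends every element path that reaches it. -/
theorem not_mem_of_mem_leaves (h : G.IsOutput nbrs os kept D) {l : List α} {N : α}
    (hN : N ∈ G.leaves l) : N ∉ os :=
  fun hN' => (mem_leaves.1 hN).2 (h.hasOut N hN')

theorem mem_R_obj (h : G.IsOutput nbrs os kept D) {O : α} {a : Att α} :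
    a ∈ D.R (.obj O) ↔ O ∈ os ∧ (a = .id ∨ ∃ N ∈ kept O, G.HasOut N ∧ a = .ref N) := by
  by_cases hO : O ∈ os
  · rw [h.R_obj O hO]; simp [hO]
  · rw [h.R_other O hO]; simp [hO]

theorem isDTD (h : G.IsOutput nbrs os kept D) : D.IsDTD where
  root_mem := by rw [h.r_eq, h.mem_L]; exact .inl rfl
  content := by
    intro a _ b hb
    rw [h.r_eq, h.mem_L]
    cases a with
    | root =>
      obtain ⟨O, hO, rfl⟩ := h.mem_symbols_root.1 hb
      exact ⟨.inr ⟨O, hO, .inl rfl⟩, by simp⟩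
    | obj O =>
      obtain ⟨hO, N, hN, rfl⟩ := h.mem_symbols_obj.1 hb
      exact ⟨.inr ⟨O, hO, .inr ⟨N, hN, rfl⟩⟩, by simp⟩
  attributes := by
    intro t _ a ha
    cases t with
    | root => simp [h.R_root] at ha
    | obj O =>
      obtain ⟨hO, rfl | ⟨N, hN, hout, rfl⟩⟩ := h.mem_R_obj.1 ha
      · exact h.id_mem_T
      · exact h.ref_mem_T O hO N hN hout

theorem isElemPath_iff (h : G.IsOutput nbrs os kept D) {w : List (Tag α)} :
    D.IsElemPath w ↔ w = [.root] ∨ ∃ O ∈ os, w = [.root, .obj O] ∨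
      ∃ N ∈ G.leaves (kept O), w = [.root, .obj O, .obj N] := by
  unfold DTD.IsElemPath
  rw [h.r_eq]
  constructor
  · rintro ⟨hhead, hchain⟩
    rcases w with _ | ⟨a, w⟩
    · simp at hhead
    obtain rfl : a = .root := by simpa using hhead
    rcases w with _ | ⟨b, w⟩
    · exact .inl rfl
    rw [List.isChain_cons_cons] at hchain
    obtain ⟨O, hO, rfl⟩ := h.mem_symbols_root.1 hchain.1
    refine .inr ⟨O, hO, ?_⟩
    rcases w with _ | ⟨b, w⟩
    · exact .inl rfl
    have hchain := List.isChain_cons_cons.1 hchain.2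
    obtain ⟨-, N, hN, rfl⟩ := h.mem_symbols_obj.1 hchain.1
    rcases w with _ | ⟨b, w⟩
    · exact .inr ⟨N, hN, rfl⟩
    have hb := (List.isChain_cons_cons.1 hchain.2).1
    exact absurd (h.mem_symbols_obj.1 hb).1 (h.not_mem_of_mem_leaves hN)
  · rintro (rfl | ⟨O, hO, rfl | ⟨N, hN, rfl⟩⟩)
    · simp
    · simp [h.mem_symbols_root, hO]
    · simp [h.mem_symbols_root, h.mem_symbols_obj, hO, hN]

theorem isPath_attr_iff (h : G.IsOutput nbrs os kept D) {w : List (Tag α)} {a : Att α} :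
    D.IsPath (.attr w a) ↔ ∃ O ∈ os, w = [.root, .obj O] ∧ a ∈ D.R (.obj O) := by
  simp only [DTD.IsPath]
  rw [h.isElemPath_iff]
  constructor
  · rintro ⟨rfl | ⟨O, hO, rfl | ⟨N, hN, rfl⟩⟩, e, he, ha⟩
    · obtain rfl : Tag.root = e := by simpa using he
      simp [h.R_root] at ha
    · obtain rfl : Tag.obj O = e := by simpa using he
      exact ⟨O, hO, rfl, ha⟩
    · obtain rfl : Tag.obj N = e := by simpa using he
      exact absurd (h.mem_R_obj.1 ha).1 (h.not_mem_of_mem_leaves hN)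
  · rintro ⟨O, hO, rfl, ha⟩
    exact ⟨.inr ⟨O, hO, .inl rfl⟩, _, rfl, ha⟩

theorem isPath_text_iff (h : G.IsOutput nbrs os kept D) {w : List (Tag α)} :
    D.IsPath (.text w) ↔
      ∃ O ∈ os, ∃ N ∈ G.leaves (kept O), w = [.root, .obj O, .obj N] := by
  simp only [DTD.IsPath]
  rw [h.isElemPath_iff]
  constructor
  · rintro ⟨rfl | ⟨O, hO, rfl | ⟨N, hN, rfl⟩⟩, e, he, ha⟩
    · obtain rfl : Tag.root = e := by simpa using he
      simp [h.P_root] at ha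
    · obtain rfl : Tag.obj O = e := by simpa using he
      simp [h.P_obj O hO] at ha
    · exact ⟨O, hO, N, hN, rfl⟩
  · rintro ⟨O, hO, N, hN, rfl⟩
    exact ⟨.inr ⟨O, hO, .inr ⟨N, hN, rfl⟩⟩, _, rfl, h.P_other N (h.not_mem_of_mem_leaves hN)⟩

/-- The path of the value of a neighbour of `O` is a path of the DTD only if the neighbour was
added to the tag of `O`. -/
theorem mem_of_isPath_valuePath (h : G.IsOutput nbrs os kept D) {O Z : α}
    (hZ : D.IsPath (G.valuePath O Z)) : O ∈ os ∧ (Z = O ∨ Z ∈ kept O) := by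
  unfold valuePath at hZ
  split_ifs at hZ with h₁ h₂
  · obtain ⟨O', hO', hw, -⟩ := h.isPath_attr_iff.1 hZ
    simp only [List.cons.injEq, Tag.obj.injEq, true_and, and_true] at hw
    subst hw
    exact ⟨hO', .inl h₁⟩
  · obtain ⟨O', hO', hw, ha⟩ := h.isPath_attr_iff.1 hZ
    simp only [List.cons.injEq, Tag.obj.injEq, true_and, and_true] at hw
    subst hw
    obtain ⟨-, ha | ⟨N, hN, -, ha⟩⟩ := h.mem_R_obj.1 ha
    · simp at ha
    · exact ⟨hO', .inr (Att.ref.inj ha ▸ hN)⟩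
  · obtain ⟨O', hO', N, hN, hw⟩ := h.isPath_text_iff.1 hZ
    simp only [List.cons.injEq, Tag.obj.injEq, true_and, and_true] at hw
    obtain ⟨rfl, rfl⟩ := hw
    exact ⟨hO', .inr (mem_leaves.1 hN).1⟩

end IsOutput

end SchemaGraph

/-! ### The tree with two elements per object -/

section TwoRowTree

variable {α : Type*}

/-- The vertices of a tree with two elements for each object of `os`, each of which has one child
for each object of `lv O`. -/
abbrev TwoRowVertex (os : List α) (lv : α → List α) : Type :=
  Option (Σ i : Fin os.length, Bool × Option (Fin (lv (os.get i)).length))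

namespace TwoRowVertex

variable {os : List α} {lv : α → List α}

/-- The children of a vertex. -/
def children : TwoRowVertex os lv → List (TwoRowVertex os lv)
  | none => (List.finRange os.length).flatMap fun i =>
      [some ⟨i, false, none⟩, some ⟨i, true, none⟩]
  | some ⟨i, b, none⟩ => (List.finRange (lv (os.get i)).length).map fun j => some ⟨i, b, some j⟩
  | some ⟨_, _, some _⟩ => []

theorem mem_children_none {u : TwoRowVertex os lv} :
    u ∈ children none ↔ ∃ i b, u = some ⟨i, b, none⟩ := by
  simp only [children, List.mem_flatMap, List.mem_finRange, true_and, List.mem_cons,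
    List.not_mem_nil, or_false, Bool.exists_bool]

theorem mem_children_some_none {i : Fin os.length} {b : Bool} {u : TwoRowVertex os lv} :
    u ∈ children (some ⟨i, b, none⟩) ↔ ∃ j, u = some ⟨i, b, some j⟩ := by
  simp only [children, List.mem_map, List.mem_finRange, true_and, eq_comm]

/-- The parent of a vertex. -/
def parent : TwoRowVertex os lv → TwoRowVertex os lv
  | some ⟨i, b, some _⟩ => some ⟨i, b, none⟩
  | _ => none

theorem parent_eq_of_mem_children {u v : TwoRowVertex os lv} (h : u ∈ children v) :
    parent u = v ∧ u ≠ none := by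
  rcases v with _ | ⟨i, b, _ | j⟩
  · obtain ⟨i, b, rfl⟩ := mem_children_none.1 h
    exact ⟨rfl, by simp⟩
  · obtain ⟨j, rfl⟩ := mem_children_some_none.1 h
    exact ⟨rfl, by simp⟩
  · simp [children] at h

theorem nodup_children (v : TwoRowVertex os lv) : (children v).Nodup := by
  rcases v with _ | ⟨i, b, _ | j⟩
  · refine List.nodup_flatMap.2 ⟨fun i _ => by simp, ?_⟩
    refine (List.nodup_finRange _).imp fun {i j} hij => ?_
    simp [List.disjoint_left, hij]
  · refine (List.nodup_finRange _).map fun j j' h => ?_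
    simpa using h
  · simp [children]

/-- The label of a vertex. -/
def label : TwoRowVertex os lv → Tag α
  | none => .root
  | some ⟨i, _, none⟩ => .obj (os.get i)
  | some ⟨i, _, some j⟩ => .obj ((lv (os.get i)).get j)

end TwoRowVertex

/-- The object whose value an attribute of `O` holds. -/
def Att.target (O : α) : Att α → α
  | .id => O
  | .ref N => N

namespace TwoRowVertex

variable {os : List α} {lv : α → List α}

/-- The content of a vertex: the text of a child of an element, and the children otherwise. -/
def content (val : α → Bool → α → String) :
    TwoRowVertex os lv → String ⊕ List (TwoRowVertex os lv)
  | some ⟨i, b, some j⟩ => .inl (val (os.get i) b ((lv (os.get i)).get j))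
  | v => .inr (children v)

theorem mem_children_iff {val : α → Bool → α → String} {u v : TwoRowVertex os lv} :
    (∃ cs, content val v = .inr cs ∧ u ∈ cs) ↔ u ∈ children v := by
  rcases v with _ | ⟨i, b, _ | j⟩
  · exact ⟨fun ⟨cs, h, hu⟩ => Sum.inr.inj h ▸ hu, fun h => ⟨_, rfl, h⟩⟩
  · exact ⟨fun ⟨cs, h, hu⟩ => Sum.inr.inj h ▸ hu, fun h => ⟨_, rfl, h⟩⟩
  · simp [content, children]

end TwoRowVertex

open TwoRowVertex in
/-- A tree with two elements for each object of `os`; the values of the objects `Z` in these two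
elements of `O` are `val O false Z` and `val O true Z`. -/
def twoRowTree [DecidableEq α] (os : List α) (lv : α → List α) (R : α → Finset (Att α))
    (val : α → Bool → α → String) : XMLTree (Tag α) (Att α) where
  V := TwoRowVertex os lv
  finite := inferInstance
  root := none
  lab := label
  ele := content val
  att
    | some ⟨i, b, none⟩, a =>
      if a ∈ R (os.get i) then some (val (os.get i) b (a.target (os.get i))) else none
    | _, _ => none
  children_nodup := by
    rintro (_ | ⟨i, b, _ | j⟩) cs h
    · exact Sum.inr.inj h ▸ nodup_children _
    · exact Sum.inr.inj h ▸ nodup_children _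
    · simp [content] at h
  root_not_child := fun v cs h hcs =>
    (parent_eq_of_mem_children (mem_children_iff.1 ⟨cs, h, hcs⟩)).2 rfl
  parent_unique := fun v v' cs cs' h h' u hu hu' =>
    (parent_eq_of_mem_children (mem_children_iff.1 ⟨cs, h, hu⟩)).1.symm.trans
      (parent_eq_of_mem_children (mem_children_iff.1 ⟨cs', h', hu'⟩)).1
  reachable := by
    simp only [mem_children_iff]
    have h₁ : ∀ i b, Relation.ReflTransGen (fun v v' : TwoRowVertex os lv => v' ∈ children v)
        none (some ⟨i, b, none⟩) :=
      fun i b => .single (mem_children_none.2 ⟨i, b, rfl⟩)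
    rintro (_ | ⟨i, b, _ | j⟩)
    · exact .refl
    · exact h₁ i b
    · exact (h₁ i b).tail (mem_children_some_none.2 ⟨j, rfl⟩)

end TwoRowTree

/-! ### Conformance of the two-row tree -/

namespace SchemaGraph.IsOutput

open TwoRowVertex

variable {α : Type*} [DecidableEq α] {G : SchemaGraph α} {nbrs : α → List α} {os : List α}
  {kept : α → List α} {D : DTD (Tag α) (Att α)} {val : α → Bool → α → String}

/-- The tree with two elements for each object that conforms to the DTD `D`. -/
abbrev tree (_h : G.IsOutput nbrs os kept D) (val : α → Bool → α → String) :
    XMLTree (Tag α) (Att α) :=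
  twoRowTree os (fun O => G.leaves (kept O)) (fun O => D.R (.obj O)) val

theorem tree_conforms (h : G.IsOutput nbrs os kept D) : (h.tree val).Conforms D where
  root_lab := h.r_eq.symm
  lab_mem := by
    rintro (_ | ⟨i, b, _ | j⟩)
    · exact (h.mem_L _).2 (.inl rfl)
    · exact (h.mem_L _).2 (.inr ⟨_, List.get_mem os i, .inl rfl⟩)
    · exact (h.mem_L _).2 (.inr ⟨_, List.get_mem os i, .inr ⟨_, List.get_mem _ j, rfl⟩⟩)
  pcdata := by
    rintro (_ | ⟨i, b, _ | j⟩) hv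
    · exact absurd (h.P_root.symm.trans hv) (by simp)
    · exact absurd ((h.P_obj _ (List.get_mem os i)).symm.trans hv) (by simp)
    · exact ⟨_, rfl⟩
  regex := by
    rintro (_ | ⟨i, b, _ | j⟩) e he
    · refine ⟨_, rfl, ?_⟩
      rw [← Content.regex.inj (h.P_root.symm.trans he)]
      have hw := mem_matches_foldl (f := fun O => (.char (.obj O) * .star (.char (.obj O)) :
          RegularExpression (Tag α))) (g := fun O => [Tag.obj O, Tag.obj O]) os (fun O _ => ?_) 1
        (w := []) rfl
      · convert hw using 1
        conv_rhs => rw [← List.map_get_finRange os]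
        change List.map (label (os := os) (lv := fun O => G.leaves (kept O))) (children none) = _
        simp only [children, List.map_flatMap, List.flatMap_map, List.nil_append]
        rfl
      · rw [RegularExpression.matches'_mul]
        -- In `O⁺`, written as `O O*`, the first element comes from `O` and the second from one
        -- round of the star.
        refine Language.append_mem_mul (a := [Tag.obj O]) (b := [Tag.obj O]) rfl ?_
        rw [RegularExpression.matches'_star]
        exact Language.mem_kstar.2 ⟨[[Tag.obj O]], by simp, by simp; rfl⟩
    · refine ⟨_, rfl, ?_⟩
      rw [← Content.regex.inj ((h.P_obj _ (List.get_mem os i)).symm.trans he)]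
      have hw := mem_matches_foldl (f := fun N => (.char (.obj N) : RegularExpression (Tag α)))
        (g := fun N => [Tag.obj N]) (G.leaves (kept (os.get i))) (fun N _ => rfl) 1
        (w := []) rfl
      convert hw using 1
      conv_rhs => rw [← List.map_get_finRange (G.leaves (kept (os.get i)))]
      change List.map (label (os := os) (lv := fun O => G.leaves (kept O)))
        (children (some ⟨i, b, none⟩)) = _
      simp only [children, List.flatMap_map, List.nil_append, List.map_map]
      rw [← List.map_eq_flatMap]
      rfl
    · exact absurd ((h.P_other _ (h.not_mem_of_mem_leaves
        (List.get_mem (G.leaves (kept (os.get i))) j))).symm.trans he) (by simp)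
  att_iff := by
    rintro (_ | ⟨i, b, _ | j⟩) a
    · change (none : Option String).isSome = true ↔ a ∈ D.R .root
      simp [h.R_root]
    · change (if a ∈ D.R (.obj (os.get i)) then some _ else none).isSome = true ↔
        a ∈ D.R (.obj (os.get i))
      split_ifs with ha
      · exact iff_of_true rfl ha
      · exact iff_of_false (by simp) ha
    · change (none : Option String).isSome = true ↔
        a ∈ D.R (.obj ((G.leaves (kept (os.get i))).get j))
      rw [h.R_other _ (h.not_mem_of_mem_leaves
        (List.get_mem (G.leaves (kept (os.get i))) j))]
      simp

end SchemaGraph.IsOutput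

/-! ### Tree tuples of the two-row tree -/

namespace SchemaGraph.IsOutput

open TwoRowVertex

variable {α : Type*} [DecidableEq α] {G : SchemaGraph α} {nbrs : α → List α} {os : List α}
  {kept : α → List α} {D : DTD (Tag α) (Att α)} {val : α → Bool → α → String}

/-- The values of the tree tuple that chooses the element `c O` for each object `O`. -/
inductive TupleValue (h : G.IsOutput nbrs os kept D) (val : α → Bool → α → String)
    (c : α → Bool) : XPath (Tag α) (Att α) → (h.tree val).V ⊕ String → Prop
  | root : TupleValue h val c (.elem [.root]) (.inl none)
  | node {O : α} (i : Fin os.length) : os.get i = O →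
      TupleValue h val c (.elem [.root, .obj O]) (.inl (some ⟨i, c O, none⟩))
  | leaf {O N : α} (i : Fin os.length) (j : Fin (G.leaves (kept (os.get i))).length) :
      os.get i = O → (G.leaves (kept (os.get i))).get j = N →
      TupleValue h val c (.elem [.root, .obj O, .obj N]) (.inl (some ⟨i, c O, some j⟩))
  | attr {O : α} {a : Att α} : a ∈ D.R (.obj O) →
      TupleValue h val c (.attr [.root, .obj O] a) (.inr (val O (c O) (a.target O)))
  | text {O N : α} : O ∈ os → N ∈ G.leaves (kept O) →
      TupleValue h val c (.text [.root, .obj O, .obj N]) (.inr (val O (c O) N))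

variable {h : G.IsOutput nbrs os kept D} {c : α → Bool}

theorem nodup_leaves (h : G.IsOutput nbrs os kept D) (hn : ∀ O ∈ os, (nbrs O).Nodup) {O : α}
    (hO : O ∈ os) : (G.leaves (kept O)).Nodup :=
  (List.filter_sublist.trans (h.kept_sublist O hO)).nodup (hn O hO)

/-- The lists of objects and of leaves have no repetitions, so a tag determines its index. -/
theorem TupleValue.unique (hn : ∀ O ∈ os, (nbrs O).Nodup) {p : XPath (Tag α) (Att α)}
    {x y : (h.tree val).V ⊕ String} (hx : TupleValue h val c p x) (hy : TupleValue h val c p y) :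
    x = y := by
  cases hx with
  | root => cases hy; rfl
  | node i hi =>
    cases hy with
    | node i' hi' =>
      obtain rfl := h.nodup.injective_get (hi.trans hi'.symm)
      rfl
  | leaf i j hi hj =>
    cases hy with
    | leaf i' j' hi' hj' =>
      obtain rfl := h.nodup.injective_get (hi.trans hi'.symm)
      obtain rfl := (h.nodup_leaves hn (List.get_mem os i)).injective_get (hj.trans hj'.symm)
      rfl
  | attr => cases hy; rfl
  | text => cases hy; rfl

/-- Every path of the DTD has a value for every choice `c`. Null values thus do not occur in this
tree, and agreement with values reduces to agreement. -/
theorem isPath_iff_exists_tupleValue (h : G.IsOutput nbrs os kept D)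
    (val : α → Bool → α → String) (c : α → Bool) {p : XPath (Tag α) (Att α)} :
    D.IsPath p ↔ ∃ x, TupleValue h val c p x := by
  constructor
  · intro hp
    rcases p with w | ⟨w, a⟩ | w
    · obtain rfl | ⟨O, hO, rfl | ⟨N, hN, rfl⟩⟩ := h.isElemPath_iff.1 hp
      · exact ⟨_, .root⟩
      · obtain ⟨i, hi⟩ := List.get_of_mem hO
        exact ⟨_, .node i hi⟩
      · obtain ⟨i, rfl⟩ := List.get_of_mem hO
        obtain ⟨j, hj⟩ := List.get_of_mem hN
        exact ⟨_, .leaf i j rfl hj⟩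
    · obtain ⟨O, hO, rfl, ha⟩ := h.isPath_attr_iff.1 hp
      exact ⟨_, .attr ha⟩
    · obtain ⟨O, hO, N, hN, rfl⟩ := h.isPath_text_iff.1 hp
      exact ⟨_, .text hO hN⟩
  · rintro ⟨x, hx⟩
    cases hx with
    | root => exact h.isElemPath_iff.2 (.inl rfl)
    | node i hi =>
      exact h.isElemPath_iff.2 (.inr ⟨_, hi ▸ List.get_mem os i, .inl rfl⟩)
    | leaf i j hi hj =>
      subst hi
      exact h.isElemPath_iff.2
        (.inr ⟨_, List.get_mem os i, .inr ⟨_, hj ▸ List.get_mem _ j, rfl⟩⟩)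
    | attr ha => exact h.isPath_attr_iff.2 ⟨_, (h.mem_R_obj.1 ha).1, rfl, ha⟩
    | text hO hN => exact h.isPath_text_iff.2 ⟨_, hO, _, hN, rfl⟩

theorem att_tree_node {i : Fin os.length} {b : Bool} {a : Att α}
    (ha : a ∈ D.R (.obj (os.get i))) :
    (h.tree val).att (some ⟨i, b, none⟩) a = some (val (os.get i) b (a.target (os.get i))) :=
  if_pos ha

theorem child_tree_iff {u v : TwoRowVertex os fun O => G.leaves (kept O)} : (h.tree val).Child v u ↔ u ∈ children v :=
  mem_children_iff (os := os) (lv := fun O => G.leaves (kept O)) (val := val)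

theorem exists_isTreeTuple (h : G.IsOutput nbrs os kept D) (hn : ∀ O ∈ os, (nbrs O).Nodup)
    (val : α → Bool → α → String) (c : α → Bool) :
    ∃ t, (h.tree val).IsTreeTuple D t ∧ ∀ p x, t p = some x ↔ TupleValue h val c p x := by
  classical
  let t : XPath (Tag α) (Att α) → Option ((h.tree val).V ⊕ String) := fun p =>
    if hp : ∃ x, TupleValue h val c p x then some hp.choose else none
  have ht : ∀ p x, t p = some x ↔ TupleValue h val c p x := by
    intro p x
    by_cases hp : ∃ x, TupleValue h val c p x
    · simp only [t, dif_pos hp, Option.some.injEq]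
      exact ⟨fun hx => hx ▸ hp.choose_spec, fun hx => hp.choose_spec.unique hn hx⟩
    · simp only [t, dif_neg hp]
      exact ⟨fun hx => by simp at hx, fun hx => absurd ⟨x, hx⟩ hp⟩
  refine ⟨t, ?_, ht⟩
  constructor
  · exact fun p hp => dif_neg fun hx => hp ((h.isPath_iff_exists_tupleValue val c).2 hx)
  · rw [h.r_eq]
    exact (ht _ _).2 .root
  · intro w a x hw hx
    rw [ht] at hx
    generalize hp : XPath.elem (w ++ [a]) = p at hx
    cases hx with
    | root =>
      have := congrArg List.length (XPath.elem.inj hp)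
      exact absurd (List.length_eq_zero_iff.1 (by simpa using this)) hw
    | @node O i hi =>
      obtain ⟨rfl, ha⟩ := List.append_inj' (s₂ := [Tag.root]) (XPath.elem.inj hp) rfl
      obtain rfl := List.singleton_inj.1 ha
      exact ⟨none, _, (ht _ _).2 .root, rfl, child_tree_iff.2 (mem_children_none.2 ⟨i, _, rfl⟩),
        congrArg Tag.obj hi⟩
    | @leaf O N i j hi hj =>
      obtain ⟨rfl, ha⟩ :=
        List.append_inj' (s₂ := [Tag.root, Tag.obj O]) (XPath.elem.inj hp) rfl
      obtain rfl := List.singleton_inj.1 ha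
      exact ⟨_, _, (ht _ _).2 (.node i hi), rfl,
        child_tree_iff.2 ((mem_children_some_none (lv := fun O => G.leaves (kept O))).2 ⟨j, rfl⟩), congrArg Tag.obj hj⟩
    | attr => simp at hp
    | text => simp at hp
  · intro w a v u hp _ _ _ hnone
    obtain ⟨x, hx⟩ := (h.isPath_iff_exists_tupleValue val c).1 hp
    rw [← ht, hnone] at hx
    simp at hx
  · intro w a hp s
    obtain ⟨O, hO, rfl, ha⟩ := h.isPath_attr_iff.1 hp
    obtain ⟨i, rfl⟩ := List.get_of_mem hO
    have hnode := (ht _ _).2 (.node i rfl)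
    have hattr := (ht _ _).2 (.attr ha)
    rw [hattr, hnode]
    constructor
    · rintro hs
      exact ⟨_, _, rfl, att_tree_node ha, (Option.some.inj hs).symm⟩
    · rintro ⟨v, str, hv, hstr, rfl⟩
      obtain rfl := Sum.inl.inj (Option.some.inj hv)
      rw [att_tree_node ha] at hstr
      rw [Option.some.inj hstr]
  · intro w hp s
    obtain ⟨O, hO, N, hN, rfl⟩ := h.isPath_text_iff.1 hp
    obtain ⟨i, rfl⟩ := List.get_of_mem hO
    obtain ⟨j, rfl⟩ := List.get_of_mem hN
    have hleaf := (ht _ _).2 (.leaf i j rfl rfl)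
    have htext := (ht _ _).2 (.text hO hN)
    rw [htext, hleaf]
    constructor
    · rintro hs
      exact ⟨_, _, rfl, rfl, (Option.some.inj hs).symm⟩
    · rintro ⟨v, str, hv, hstr, rfl⟩
      obtain rfl := Sum.inl.inj (Option.some.inj hv)
      rw [← Sum.inl.inj hstr]

/-- By maximality a tuple chooses one of the two elements of each object. Below an element there is
only one child for each leaf, so these Boolean choices fix the tuple. -/
theorem exists_tupleValue_of_isTreeTuple (h : G.IsOutput nbrs os kept D)
    (hn : ∀ O ∈ os, (nbrs O).Nodup) {t : XPath (Tag α) (Att α) → Option ((h.tree val).V ⊕ String)}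
    (ht : (h.tree val).IsTreeTuple D t) :
    ∃ c, ∀ p x, TupleValue h val c p x → t p = some x := by
  have hroot : t (.elem [.root]) = some (.inl none) := by
    have := ht.root
    rw [h.r_eq] at this
    exact this
  have hnode : ∀ i, ∃ b, t (.elem [.root, .obj (os.get i)]) = some (.inl (some ⟨i, b, none⟩)) := by
    intro i
    have hp : D.IsPath (.elem ([.root] ++ [.obj (os.get i)])) :=
      h.isElemPath_iff.2 (.inr ⟨_, List.get_mem os i, .inl rfl⟩)
    -- Either of the two elements serves here: it only shows that the tuple has some value at this
    -- path.
    have hne := ht.elem_maximal [.root] (.obj (os.get i)) none (some ⟨i, false, none⟩) hp hroot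
      (child_tree_iff.2 (mem_children_none.2 ⟨i, _, rfl⟩)) rfl
    obtain ⟨x, hx⟩ := Option.ne_none_iff_exists'.1 hne
    obtain ⟨v, u, hv, rfl, huv, hu⟩ := ht.elem_value _ _ _ (by simp) hx
    obtain rfl := Sum.inl.inj (Option.some.inj (hroot.symm.trans hv))
    obtain ⟨i', b, rfl⟩ := mem_children_none.1 (child_tree_iff.1 huv)
    obtain rfl := h.nodup.injective_get (Tag.obj.inj hu)
    exact ⟨b, hx⟩
  choose b hb using hnode
  classical
  -- Transport the choices from indices to objects; the value `false` outside `os` plays no role.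
  have hc : ∃ c : α → Bool, ∀ i, c (os.get i) = b i :=
    ⟨fun O => if hO : ∃ i, os.get i = O then b hO.choose else false, fun i => by
      have hO : ∃ i', os.get i' = os.get i := ⟨i, rfl⟩
      simp only [dif_pos hO]
      rw [h.nodup.injective_get hO.choose_spec]⟩
  obtain ⟨c, hc⟩ := hc
  have hleaf : ∀ i j, t (.elem [.root, .obj (os.get i),
      .obj ((G.leaves (kept (os.get i))).get j)]) = some (.inl (some ⟨i, b i, some j⟩)) := by
    intro i j
    have hp : D.IsPath (.elem ([.root, .obj (os.get i)] ++
        [.obj ((G.leaves (kept (os.get i))).get j)])) :=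
      h.isElemPath_iff.2 (.inr ⟨_, List.get_mem os i, .inr ⟨_, List.get_mem _ j, rfl⟩⟩)
    have hne := ht.elem_maximal [.root, .obj (os.get i)] _ _ (some ⟨i, b i, some j⟩) hp (hb i)
      (child_tree_iff.2 ((mem_children_some_none (lv := fun O => G.leaves (kept O))).2 ⟨j, rfl⟩)) rfl
    obtain ⟨x, hx⟩ := Option.ne_none_iff_exists'.1 hne
    obtain ⟨v, u, hv, rfl, huv, hu⟩ := ht.elem_value _ _ _ (by simp) hx
    obtain rfl := Sum.inl.inj (Option.some.inj ((hb i).symm.trans hv))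
    obtain ⟨j', rfl⟩ := mem_children_some_none.1 (child_tree_iff.1 huv)
    obtain rfl := (h.nodup_leaves hn (List.get_mem os i)).injective_get (Tag.obj.inj hu)
    exact hx
  refine ⟨c, fun p x hx => ?_⟩
  have hp := (h.isPath_iff_exists_tupleValue val c).2 ⟨x, hx⟩
  cases hx with
  | root => exact hroot
  | node i hi => subst hi; rw [hc]; exact hb i
  | leaf i j hi hj => subst hi hj; rw [hc]; exact hleaf i j
  | attr ha =>
    obtain ⟨i, rfl⟩ := List.get_of_mem (h.mem_R_obj.1 ha).1
    rw [hc]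
    exact (ht.attr_value _ _ hp _).2 ⟨_, _, hb i, att_tree_node ha, rfl⟩
  | text hO hN =>
    obtain ⟨i, rfl⟩ := List.get_of_mem hO
    obtain ⟨j, rfl⟩ := List.get_of_mem hN
    rw [hc]
    exact (ht.text_value _ hp _).2 ⟨_, _, hleaf i j, rfl, rfl⟩

theorem tupleValue_valuePath (val : α → Bool → α → String) (c : α → Bool) {O Z : α}
    (hZ : D.IsPath (G.valuePath O Z)) :
    TupleValue h val c (G.valuePath O Z) (.inr (val O (c O) Z)) := by
  obtain ⟨x, hx⟩ := (h.isPath_iff_exists_tupleValue val c).1 hZ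
  unfold valuePath at hx ⊢
  split_ifs at hx ⊢ with h₁ h₂
  · subst h₁; cases hx with | attr ha => exact .attr ha
  · cases hx with | attr ha => exact .attr ha
  · cases hx with | text hO hN => exact .text hO hN

end SchemaGraph.IsOutput

/-! ### General facts on tree tuples -/

section Semantics

variable {El At : Type*} {D : DTD El At} {T : XMLTree El At}

theorem XMLTree.IsTreeTuple.exists_vertex {t : XPath El At → Option (T.V ⊕ String)}
    (ht : T.IsTreeTuple D t) {w : List El} {a : El} (hw : w ≠ [])
    (hne : t (.elem (w ++ [a])) ≠ none) :
    ∃ v u, t (.elem w) = some (.inl v) ∧ t (.elem (w ++ [a])) = some (.inl u) ∧ T.Child v u ∧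
      T.lab u = a := by
  obtain ⟨x, hx⟩ := Option.ne_none_iff_exists'.1 hne
  obtain ⟨v, u, hv, rfl, hvu, hu⟩ := ht.elem_value w a x hw hx
  exact ⟨v, u, hv, hx, hvu, hu⟩

/-- Two tree tuples that agree, with values, on an element agree on its parent. -/
theorem XMLTree.IsTreeTuple.parent_eq {t₁ t₂ : XPath El At → Option (T.V ⊕ String)}
    (ht₁ : T.IsTreeTuple D t₁) (ht₂ : T.IsTreeTuple D t₂) {w : List El} {a : El} (hw : w ≠ [])
    (heq : t₁ (.elem (w ++ [a])) = t₂ (.elem (w ++ [a]))) (hne : t₁ (.elem (w ++ [a])) ≠ none) :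
    t₁ (.elem w) = t₂ (.elem w) := by
  obtain ⟨v₁, u₁, hv₁, hu₁, ⟨cs₁, hcs₁, hmem₁⟩, -⟩ := ht₁.exists_vertex hw hne
  obtain ⟨v₂, u₂, hv₂, hu₂, ⟨cs₂, hcs₂, hmem₂⟩, -⟩ := ht₂.exists_vertex hw (heq ▸ hne)
  obtain rfl : u₁ = u₂ := Sum.inl.inj (Option.some.inj (hu₁.symm.trans (heq.trans hu₂)))
  rw [hv₁, hv₂, T.parent_unique v₁ v₂ cs₁ cs₂ hcs₁ hcs₂ u₁ hmem₁ hmem₂]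

/-- An element whose tag has the attribute `a` has a value of this attribute. -/
theorem XMLTree.IsTreeTuple.elem_eq_none {t : XPath El At → Option (T.V ⊕ String)}
    (ht : T.IsTreeTuple D t) (hT : T.Conforms D) {w : List El} {e : El} (hw : w ≠ []) {a : At}
    (ha : a ∈ D.R e) (hp : D.IsPath (.attr (w ++ [e]) a)) (hnone : t (.attr (w ++ [e]) a) = none) :
    t (.elem (w ++ [e])) = none := by
  by_contra hne
  obtain ⟨v, u, -, hu, -, rfl⟩ := ht.exists_vertex hw hne
  obtain ⟨s, hs⟩ := Option.isSome_iff_exists.1 ((hT.att_iff u a).2 ha)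
  have := (ht.attr_value _ _ hp _).2 ⟨u, s, hu, hs, rfl⟩
  rw [hnone] at this
  simp at this

theorem DTD.Implies.of_mem_rhs {S : Set (XFD El At)} {X : Finset (XPath El At)}
    {q : XPath El At} (hq : q ∈ X) : D.Implies S ⟨X, {q}⟩ := by
  intro T _ _ t₁ t₂ _ _ hX p hp
  rw [Finset.mem_singleton.1 hp]
  exact (hX q hq).1

end Semantics

/-! ### Prescribed agreement as a counterexample -/

open Classical in
/-- The values in a tree whose two elements of `O` agree exactly on the values in `E O`. -/
noncomputable def agreeOn {α : Type*} (E : α → Set α) (O : α) (b : Bool) (Z : α) : String :=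
  toString (b && decide (Z ∉ E O))

theorem agreeOn_eq_iff {α : Type*} {E : α → Set α} {O Z : α} {b b' : Bool} :
    agreeOn E O b Z = agreeOn E O b' Z ↔ Z ∈ E O ∨ b = b' := by
  have hinj : ∀ b b' : Bool, toString b = toString b' → b = b' := by decide
  constructor
  · intro h
    by_cases hZ : Z ∈ E O
    · exact .inl hZ
    · simpa [hZ] using hinj _ _ h
  · rintro (h | rfl)
    · simp [agreeOn, h]
    · rfl

namespace SchemaGraph

variable {α : Type*} [DecidableEq α]

namespace IsOutput

variable {G : SchemaGraph α} {nbrs : α → List α} {os : List α} {kept : α → List α}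
  {D : DTD (Tag α) (Att α)} {B : Set (FD α)}

/-- The tree with two elements for each object `O` that agree exactly on the values in `E O`
satisfies the induced dependencies. -/
theorem tree_satisfies (h : G.IsOutput nbrs os kept D) (hn : ∀ O ∈ os, (nbrs O).Nodup)
    {E : α → Set α} (hE : ∀ O, O ∉ E O)
    (hclosed : ∀ O (U V : Finset α), U.Nonempty → Infers (G.fds ∪ B) U V → (U : Set α) ⊆ E O →
      (V : Set α) ⊆ E O) {φ : XFD (Tag α) (Att α)} (hφ : φ ∈ G.inducedXFDs B D) :
    (h.tree (agreeOn E)).Satisfies D φ := by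
  intro t₁ t₂ ht₁ ht₂ hlhs q hq
  obtain ⟨c₁, hc₁⟩ := h.exists_tupleValue_of_isTreeTuple hn ht₁
  obtain ⟨c₂, hc₂⟩ := h.exists_tupleValue_of_isTreeTuple hn ht₂
  obtain ⟨hover, hφ⟩ := hφ
  have hvalue : ∀ O Z, D.IsPath (G.valuePath O Z) →
      (t₁ (G.valuePath O Z) = t₂ (G.valuePath O Z) ↔ Z ∈ E O ∨ c₁ O = c₂ O) := by
    intro O Z hZ
    rw [hc₁ _ _ (h.tupleValue_valuePath (agreeOn E) c₁ hZ),
      hc₂ _ _ (h.tupleValue_valuePath (agreeOn E) c₂ hZ), ← agreeOn_eq_iff (E := E)]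
    exact ⟨fun h => Sum.inr.inj (Option.some.inj h), fun h => h ▸ rfl⟩
  have helem : ∀ O, D.IsPath (.elem [.root, .obj O]) →
      t₁ (.elem [.root, .obj O]) = t₂ (.elem [.root, .obj O]) → c₁ O = c₂ O := by
    intro O hO heq
    obtain ⟨x, hx⟩ := (h.isPath_iff_exists_tupleValue (agreeOn E) c₁).1 hO
    cases hx with
    | node i hi =>
      rw [hc₁ _ _ (.node i hi), hc₂ _ _ (.node i hi)] at heq
      have := Option.some.inj (Sum.inl.inj (Option.some.inj heq))
      simpa using this
  have hall : ∀ O, c₁ O = c₂ O → ∀ p, D.IsPath p →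
      (p = .elem [.root, .obj O] ∨ (∃ N, p = .elem [.root, .obj O, .obj N]) ∨
        (∃ a, p = .attr [.root, .obj O] a)) → t₁ p = t₂ p := by
    intro O hO p hp hpO
    obtain ⟨x, hx⟩ := (h.isPath_iff_exists_tupleValue (agreeOn E) c₁).1 hp
    rw [hc₁ _ _ hx]
    symm
    apply hc₂
    rcases hpO with rfl | ⟨N, rfl⟩ | ⟨a, rfl⟩
    · cases hx with | node i hi => exact hO ▸ .node i hi
    · cases hx with | leaf i j hi hj => exact hO ▸ .leaf i j hi hj
    · cases hx with | attr ha => exact hO ▸ .attr ha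
  rcases hφ with ⟨O, rfl⟩ | ⟨f, -, rfl⟩ | ⟨f, -, rfl⟩ | ⟨O, X, Y, -, -, hXY, rfl⟩
  · obtain rfl := Finset.mem_singleton.1 hq
    refine hall O ?_ _ (hover.rhs_paths _ hq) (.inl rfl)
    have hid : G.valuePath O O = .attr [.root, .obj O] .id := if_pos rfl
    have hmem := Finset.mem_singleton_self (XPath.attr [Tag.root, .obj O] (Att.id : Att α))
    have := (hvalue O O (hid ▸ hover.lhs_paths _ hmem)).1 (hid ▸ (hlhs _ hmem).1)
    -- As `O ∉ E O`, the two elements of `O` have different identifiers, so equal identifiers force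
    -- the same choice.
    exact this.resolve_left (hE O)
  · obtain rfl := Finset.mem_singleton.1 hq
    have hmem := Finset.mem_singleton_self (XPath.elem [Tag.root, .obj f.1] : XPath _ (Att α))
    exact hall f.1 (helem _ (hover.lhs_paths _ hmem) (hlhs _ hmem).1) _ (hover.rhs_paths _ hq)
      (.inr (.inl ⟨_, rfl⟩))
  · obtain rfl := Finset.mem_singleton.1 hq
    have hmem := Finset.mem_singleton_self (XPath.elem [Tag.root, .obj f.1] : XPath _ (Att α))
    exact hall f.1 (helem _ (hover.lhs_paths _ hmem) (hlhs _ hmem).1) _ (hover.rhs_paths _ hq)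
      (.inr (.inr ⟨_, rfl⟩))
  · obtain ⟨Z, hZ, rfl⟩ := Finset.mem_image.1 hq
    rw [hvalue O Z (hover.rhs_paths _ hq)]
    by_cases hc : c₁ O = c₂ O
    · exact .inr hc
    · refine .inl (hclosed O X Y (Finset.image_nonempty.1 hover.lhs_nonempty) hXY ?_ hZ)
      intro U hU
      have hmem := Finset.mem_image_of_mem (G.valuePath O) (Finset.mem_coe.1 hU)
      exact ((hvalue O U (hover.lhs_paths _ hmem)).1 (hlhs _ hmem).1).resolve_right hc

/-- An implied dependency between values of neighbours of `O`, among paths that do not determine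
the element of `O`, is inferred, unless the left-hand side determines `O`. -/
theorem infers_of_implies (h : G.IsOutput nbrs os kept D) (hn : ∀ O ∈ os, (nbrs O).Nodup)
    {X : Finset (XPath (Tag α) (Att α))} {O A : α} {Z : Finset α}
    (hXZ : ∀ p ∈ X, D.IsPath p ∧
      ((∃ z ∈ Z, p = G.valuePath O z) ∨ ∀ val c c', (∀ O' ≠ O, c O' = c' O') →
        ∀ x, TupleValue h val c p x → TupleValue h val c' p x))
    (hA : D.IsPath (G.valuePath O A)) (hO : ¬ Infers (G.fds ∪ B) Z {O})
    (himp : D.Implies (G.inducedXFDs B D) ⟨X, {G.valuePath O A}⟩) :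
    Infers (G.fds ∪ B) Z {A} := by
  -- The attribute closure of `Z` at `O`, and the empty set at every other object.
  set E : α → Set α := fun O' => {z | O' = O ∧ Infers (G.fds ∪ B) Z {z}} with hEdef
  have hE : ∀ O', O' ∉ E O' := by
    rintro O' ⟨rfl, hO'⟩
    exact hO hO'
  have hclosed : ∀ O' (U V : Finset α), U.Nonempty → Infers (G.fds ∪ B) U V →
      (U : Set α) ⊆ E O' → (V : Set α) ⊆ E O' := by
    intro O' U V hU hUV hUE v hv
    -- An element of `U` forces `O' = O`; the empty set would lie in every `E O'`.
    obtain ⟨u, hu⟩ := hU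
    exact ⟨(hUE hu).1, Infers.closure_closed hUV (fun u hu => (hUE hu).2) v hv⟩
  have hsat := himp (h.tree (agreeOn E)) h.tree_conforms
    fun ψ hψ => h.tree_satisfies hn hE hclosed hψ
  obtain ⟨t₁, ht₁, hv₁⟩ := h.exists_isTreeTuple hn (agreeOn E) (fun _ => false)
  -- The second tuple differs from the first only in its element of `O`.
  obtain ⟨t₂, ht₂, hv₂⟩ := h.exists_isTreeTuple hn (agreeOn E) (fun O' => decide (O' = O))
  have hq := hsat t₁ t₂ ht₁ ht₂ ?_ _ (Finset.mem_singleton_self _)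
  · rw [(hv₁ _ _).2 (h.tupleValue_valuePath _ _ hA),
      (hv₂ _ _).2 (h.tupleValue_valuePath _ _ hA)] at hq
    have := agreeOn_eq_iff.1 (Sum.inr.inj (Option.some.inj hq))
    simpa [hEdef] using this
  · intro p hp
    obtain ⟨hpath, hpZ⟩ := hXZ p hp
    obtain ⟨x, hx⟩ := (h.isPath_iff_exists_tupleValue (agreeOn E) (fun _ => false)).1 hpath
    refine ⟨?_, by rw [(hv₁ _ _).2 hx]; simp⟩
    rcases hpZ with ⟨z, hz, rfl⟩ | hpO
    · rw [(hv₁ _ _).2 (h.tupleValue_valuePath _ _ hpath),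
        (hv₂ _ _).2 (h.tupleValue_valuePath _ _ hpath)]
      have hzE : z ∈ E O := ⟨rfl, .reflexivity (Finset.singleton_subset_iff.2 hz)⟩
      rw [agreeOn_eq_iff.2 (.inl hzE)]
    · rw [(hv₁ _ _).2 hx, (hv₂ _ _).2 (hpO _ _ _ (fun O' hO' => by simp [hO']) _ hx)]

end IsOutput

end SchemaGraph

/-! ### The normal form for irredundant graphs -/

namespace SchemaGraph

variable {α : Type*} [DecidableEq α]

namespace IsOutput

variable {G : SchemaGraph α} {nbrs : α → List α} {os : List α} {kept : α → List α}
  {D : DTD (Tag α) (Att α)} {B₀ B : Set (FD α)} {X : Finset (XPath (Tag α) (Att α))}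

theorem valuePath_self (G : SchemaGraph α) (O : α) :
    G.valuePath O O = .attr [.root, .obj O] .id :=
  if_pos rfl

theorem isPath_valuePath_self (h : G.IsOutput nbrs os kept D) {O : α} (hO : O ∈ os) :
    D.IsPath (G.valuePath O O) := by
  rw [valuePath_self]
  exact h.isPath_attr_iff.2 ⟨O, hO, rfl, h.mem_R_obj.2 ⟨hO, .inl rfl⟩⟩

theorem isPath_elem (h : G.IsOutput nbrs os kept D) {O : α} (hO : O ∈ os) :
    D.IsPath (.elem [.root, .obj O]) :=
  h.isElemPath_iff.2 (.inr ⟨O, hO, .inl rfl⟩)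

/-- The attribute `@ID` of `O` determines the element of `O`. -/
theorem implies_elem_of_implies_id (h : G.IsOutput nbrs os kept D) {O : α} (hO : O ∈ os)
    (himp : D.Implies (G.inducedXFDs B D) ⟨X, {G.valuePath O O}⟩) :
    D.Implies (G.inducedXFDs B D) ⟨X, {.elem [.root, .obj O]}⟩ := by
  have hp := h.isPath_valuePath_self hO
  rw [valuePath_self] at himp hp
  intro T hT hS t₁ t₂ ht₁ ht₂ hX q hq
  obtain rfl := Finset.mem_singleton.1 hq
  have hid := himp T hT hS t₁ t₂ ht₁ ht₂ hX _ (Finset.mem_singleton_self _)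
  have hR : Att.id ∈ D.R (.obj O) := h.mem_R_obj.2 ⟨hO, .inl rfl⟩
  -- The key FD applies only to identifiers with values. A missing identifier means a missing
  -- element, since conformance makes `@ID` mandatory; then both tuples have no value at `ε.O`.
  by_cases hnone : t₁ (.attr [.root, .obj O] .id) = none
  · exact (ht₁.elem_eq_none hT (w := [.root]) (by simp) hR hp hnone).trans
      (ht₂.elem_eq_none hT (w := [.root]) (by simp) hR hp (hid ▸ hnone)).symm
  · have hφ : (⟨{.attr [.root, .obj O] .id}, {.elem [.root, .obj O]}⟩ : XFD _ _) ∈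
        G.inducedXFDs B D :=
      ⟨⟨Finset.singleton_nonempty _, Finset.singleton_nonempty _,
        fun p hp' => Finset.mem_singleton.1 hp' ▸ hp,
        fun p hp' => Finset.mem_singleton.1 hp' ▸ h.isPath_elem hO⟩, .inl ⟨O, rfl⟩⟩
    refine hS _ hφ t₁ t₂ ht₁ ht₂ (fun p hp' => ?_) _ (Finset.mem_singleton_self _)
    obtain rfl := Finset.mem_singleton.1 hp'
    exact ⟨hid, hnone⟩

/-- The element of `O` determines its children. -/
theorem implies_child_of_implies_elem (h : G.IsOutput nbrs os kept D) {O N : α} (hO : O ∈ os)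
    (hN : N ∈ G.leaves (kept O)) (hON : (O, N) ∈ G.arr)
    (himp : D.Implies (G.inducedXFDs B D) ⟨X, {.elem [.root, .obj O]}⟩) :
    D.Implies (G.inducedXFDs B D) ⟨X, {.elem [.root, .obj O, .obj N]}⟩ := by
  intro T hT hS t₁ t₂ ht₁ ht₂ hX q hq
  obtain rfl := Finset.mem_singleton.1 hq
  have helem := himp T hT hS t₁ t₂ ht₁ ht₂ hX _ (Finset.mem_singleton_self _)
  have hnone : ∀ t, T.IsTreeTuple D t → t (.elem [.root, .obj O]) = none →
      t (.elem [.root, .obj O, .obj N]) = none := by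
    intro t ht htO
    by_contra hne
    obtain ⟨v, u, hv, -⟩ := ht.exists_vertex (w := [.root, .obj O]) (by simp) hne
    rw [htO] at hv
    simp at hv
  -- The FD from the element to its child says nothing about null values; but without a parent both
  -- children are null.
  by_cases h₁ : t₁ (.elem [.root, .obj O]) = none
  · rw [hnone t₁ ht₁ h₁, hnone t₂ ht₂ (helem ▸ h₁)]
  · have hφ : (⟨{.elem [.root, .obj O]}, {.elem [.root, .obj O, .obj N]}⟩ : XFD _ _) ∈
        G.inducedXFDs B D :=
      ⟨⟨Finset.singleton_nonempty _, Finset.singleton_nonempty _,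
        fun p hp => Finset.mem_singleton.1 hp ▸ h.isPath_elem hO,
        fun p hp => Finset.mem_singleton.1 hp ▸
          h.isElemPath_iff.2 (.inr ⟨O, hO, .inr ⟨N, hN, rfl⟩⟩)⟩, .inr (.inl ⟨_, hON, rfl⟩)⟩
    refine hS _ hφ t₁ t₂ ht₁ ht₂ (fun p hp => ?_) _ (Finset.mem_singleton_self _)
    obtain rfl := Finset.mem_singleton.1 hp
    exact ⟨helem, h₁⟩

/-- A set of paths that contains the values of `Z` determines what `Z` determines. -/
theorem implies_valuePath_of_infers (hX : ∀ p ∈ X, D.IsPath p) {O A : α} {Z : Finset α} (hZne : Z.Nonempty)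
    (hZ : ∀ z ∈ Z, z ∈ G.outNbr O ∧ G.valuePath O z ∈ X) (hA : A ∈ insert O (G.outNbr O))
    (hAp : D.IsPath (G.valuePath O A)) (hinf : Infers (G.fds ∪ B) Z {A}) :
    D.Implies (G.inducedXFDs B D) ⟨X, {G.valuePath O A}⟩ := by
  intro T hT hS t₁ t₂ ht₁ ht₂ hagree q hq
  have hZX : ∀ p ∈ Z.image (G.valuePath O), p ∈ X := by
    intro p hp
    obtain ⟨z, hz, rfl⟩ := Finset.mem_image.1 hp
    exact (hZ z hz).2
  refine hS ⟨Z.image (G.valuePath O), ({A} : Finset α).image (G.valuePath O)⟩ ⟨?_, ?_⟩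
    t₁ t₂ ht₁ ht₂ (fun p hp => hagree p (hZX p hp)) q (by simpa using hq)
  · exact ⟨hZne.image _, (Finset.singleton_nonempty A).image _, fun p hp => hX p (hZX p hp),
      by simpa using hAp⟩
  · exact .inr (.inr (.inr ⟨O, Z, {A}, fun z hz => Finset.mem_insert_of_mem (hZ z hz).1,
      Finset.singleton_subset_iff.2 hA, hinf, rfl⟩))

/-- The core of the normal form: either `X` visibly determines the element of `O`, or the two-row
tree and irredundance contradict each other. -/
theorem implies_elem_of_implies_valuePath (h : G.IsOutput nbrs os kept D)
    (hn : ∀ O ∈ os, (nbrs O).Nodup) (hnbrs : ∀ O ∈ os, ∀ N ∈ nbrs O, N ∈ G.outNbr O)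
    (hB₀ : B₀ ⊆ B) (hB : ∀ φ ∈ B, Infers (G.fds ∪ B₀) φ.lhs φ.rhs)
    (hne : ∀ φ ∈ G.fds ∪ B, φ.lhs.Nonempty) (hG : ∀ f ∈ G.arr, Irredundant B₀ G f)
    (hX : ∀ p ∈ X, D.IsPath p) {O A : α} (hA : D.IsPath (G.valuePath O A))
    (hAX : G.valuePath O A ∉ X)
    (himp : D.Implies (G.inducedXFDs B D) ⟨X, {G.valuePath O A}⟩) :
    D.Implies (G.inducedXFDs B D) ⟨X, {.elem [.root, .obj O]}⟩ := by
  obtain ⟨hO, hAO⟩ := h.mem_of_isPath_valuePath hA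
  have hkept : ∀ O ∈ os, ∀ N ∈ kept O, N ∈ G.outNbr O ∧ N ≠ O := by
    intro O hO N hN
    have hmem := hnbrs O hO N ((h.kept_sublist O hO).subset hN)
    exact ⟨hmem, ((hG _ (mem_outNbr.1 hmem)).fst_ne_snd).symm⟩
  by_cases hAO' : A = O
  · subst hAO'
    exact h.implies_elem_of_implies_id hO himp
  have hA' := (hkept O hO A (hAO.resolve_left hAO')).1
  by_cases helem : .elem [.root, .obj O] ∈ X
  · exact .of_mem_rhs helem
  by_cases hid : .attr [.root, .obj O] .id ∈ X
  · exact h.implies_elem_of_implies_id hO (.of_mem_rhs (by rwa [valuePath_self]))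
  by_cases hchild : ∃ N, .elem [.root, .obj O, .obj N] ∈ X
  · obtain ⟨N, hN⟩ := hchild
    intro T _ _ t₁ t₂ ht₁ ht₂ hagree q hq
    obtain rfl := Finset.mem_singleton.1 hq
    exact ht₁.parent_eq ht₂ (w := [.root, .obj O]) (by simp) (hagree _ hN).1 (hagree _ hN).2
  -- All neighbours of `O` whose values are in `X`. The paths `ε.O`, `ε.O.@ID` and `ε.O.N` are
  -- already excluded, so every other path of `X` is independent of the choice at `O`.
  set Z := (G.outNbr O).filter fun z => G.valuePath O z ∈ X with hZdef
  have hZ : ∀ z ∈ Z, z ∈ G.outNbr O ∧ G.valuePath O z ∈ X := fun z hz => Finset.mem_filter.1 hz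
  by_cases hZO : Infers (G.fds ∪ B) Z {O}
  · exact h.implies_elem_of_implies_id hO (implies_valuePath_of_infers hX
      (hZO.lhs_nonempty hne (Finset.singleton_nonempty O)) hZ (Finset.mem_insert_self _ _)
      (h.isPath_valuePath_self hO) hZO)
  -- The tree gives `Z → A`; irredundance then gives `Z → O`, contrary to `hZO`.
  refine absurd (infers_source_of_infers_outNbr hB₀ hB hG (fun z hz => (hZ z hz).1) hA'
    (fun hAZ => hAX (hZ A hAZ).2) (h.infers_of_implies hn (fun p hp => ⟨hX p hp, ?_⟩) hA hZO himp))
    hZO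
  by_cases hpZ : ∃ z ∈ Z, p = G.valuePath O z
  · exact .inl hpZ
  refine .inr fun val c c' hc x hx => ?_
  have hmemZ : ∀ z, z ∈ G.outNbr O → p = G.valuePath O z → False := fun z hz hpz =>
    hpZ ⟨z, Finset.mem_filter.2 ⟨hz, hpz ▸ hp⟩, hpz⟩
  cases hx with
  | root => exact .root
  | node i hi => exact hc _ (fun hO' => helem (hO' ▸ hp)) ▸ .node i hi
  | @leaf O' N i j hi hj =>
    exact hc O' (fun hO' => hchild ⟨N, hO' ▸ hp⟩) ▸ .leaf i j hi hj
  | @attr O' a ha =>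
    refine hc O' (fun hO' => ?_) ▸ .attr ha
    subst hO'
    obtain ⟨-, rfl | ⟨N, hN, hout, rfl⟩⟩ := h.mem_R_obj.1 ha
    · exact hid hp
    · obtain ⟨hN', hNO⟩ := hkept _ hO N hN
      exact hmemZ N hN' (by rw [valuePath, if_neg hNO, if_pos hout])
  | @text O' N hO' hN =>
    refine hc O' (fun hOO => ?_) ▸ .text hO' hN
    subst hOO
    obtain ⟨hN, hout⟩ := mem_leaves.1 hN
    obtain ⟨hN', hNO⟩ := hkept _ hO N hN
    exact hmemZ N hN' (by rw [valuePath, if_neg hNO, if_neg hout])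

/-- The DTD of a graph without redundant arrows is in XML normal form. -/
theorem inXMLNormalForm (h : G.IsOutput nbrs os kept D) (hn : ∀ O ∈ os, (nbrs O).Nodup)
    (hnbrs : ∀ O ∈ os, ∀ N ∈ nbrs O, N ∈ G.outNbr O)
    (hB₀ : B₀ ⊆ B) (hB : ∀ φ ∈ B, Infers (G.fds ∪ B₀) φ.lhs φ.rhs)
    (hne : ∀ φ ∈ G.fds ∪ B, φ.lhs.Nonempty) (hG : ∀ f ∈ G.arr, Irredundant B₀ G f) :
    D.InXMLNormalForm (G.inducedXFDs B D) := by
  intro X w q hq hover himp hnontriv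
  -- This is the only use of nontriviality.
  have hqX : q ∉ X := fun hq => hnontriv (.of_mem_rhs hq)
  have hpath := hover.rhs_paths q (Finset.mem_singleton_self q)
  have hkept : ∀ O ∈ os, ∀ N ∈ kept O, (O, N) ∈ G.arr ∧ N ≠ O := by
    intro O hO N hN
    have hmem := mem_outNbr.1 (hnbrs O hO N ((h.kept_sublist O hO).subset hN))
    exact ⟨hmem, ((hG _ hmem).fst_ne_snd).symm⟩
  have key : ∀ O A, q = G.valuePath O A →
      D.Implies (G.inducedXFDs B D) ⟨X, {.elem [.root, .obj O]}⟩ := by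
    rintro O A rfl
    exact h.implies_elem_of_implies_valuePath hn hnbrs hB₀ hB hne hG hover.lhs_paths hpath hqX himp
  rcases hq with ⟨a, rfl⟩ | rfl
  · obtain ⟨O, hO, rfl, ha⟩ := h.isPath_attr_iff.1 hpath
    obtain ⟨-, rfl | ⟨N, hN, hout, rfl⟩⟩ := h.mem_R_obj.1 ha
    · exact key O O (valuePath_self G O).symm
    · exact key O N (by rw [valuePath, if_neg (hkept O hO N hN).2, if_pos hout])
  · obtain ⟨O, hO, N, hN, rfl⟩ := h.isPath_text_iff.1 hpath
    obtain ⟨hN', hout⟩ := mem_leaves.1 hN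
    obtain ⟨harr, hNO⟩ := hkept O hO N hN'
    -- For a text the target is the child `ε.O.N`, one level below the element that `key`
    -- determines.
    exact h.implies_child_of_implies_elem hO hN harr
      (key O N (by rw [valuePath, if_neg hNO, if_neg hout]))

end IsOutput

end SchemaGraph

/-! ### Application to the first reduced representation -/

/-- The DTD obtained from a first reduced representation of a category, with its induced XML
functional dependencies, is in XML normal form. -/
theorem mainTheorem3 {C : Type*} [SmallCategory C] [Fintype C] [DecidableEq C]
    (G : SchemaGraph C) (hG : G.Represents)
    (F : Finset (FD C)) (hF : ∀ φ ∈ F, φ.lhs.Nonempty)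
    (F₀ : Finset (FD C)) (hF₀ : F₀ ⊆ F)
    (arrows : List (ClosureObj C × ClosureObj C))
    (harrows : Enumerates arrows (closureGraph G F).arr)
    (H : SchemaGraph (ClosureObj C)) (hH : H = firstReduced G F F₀ arrows)
    (skip : Bool)
    (objs : List (ClosureObj C)) (hobjs : Enumerates objs H.obj)
    (nbrs : ClosureObj C → List (ClosureObj C))
    (hnbrs : ∀ O ∈ H.obj, Enumerates (nbrs O) (H.outNbr O))
    (D : DTD (Tag (ClosureObj C)) (Att (ClosureObj C))) (hD : D = H.toDTD skip objs nbrs) :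
    D.IsDTD ∧ D.InXMLNormalForm (H.inducedXFDs (liftFDs F) D) := by
  have hred : SchemaGraph.IsReduction (liftFDs F₀) (closureGraph G F) H :=
    hH ▸ SchemaGraph.isReduction_reduce _ _ _
  have hirr : ∀ f ∈ H.arr, SchemaGraph.Irredundant (liftFDs F₀) H f := by
    intro f hf
    -- Irredundance is known only for arrows that were examined, so it matters that the list runs
    -- through all arrows of the closure.
    have hl := (harrows.2 f).2 (hred.arr_subset hf)
    subst hH
    exact SchemaGraph.irredundant_reduce _ _ _ hl hf
  obtain ⟨os, kept, h⟩ := H.exists_isOutput_toDTD skip objs nbrs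
  rw [← hD] at h
  have hos : ∀ O ∈ os, O ∈ H.obj := by
    intro O hO
    obtain ⟨f, hf, rfl⟩ := h.hasOut O hO
    rw [hred.obj_eq]
    exact fst_mem_closureGraph_obj (hred.arr_subset hf)
  refine ⟨h.isDTD, h.inXMLNormalForm (fun O hO => (hnbrs O (hos O hO)).1)
    (fun O hO N hN => ((hnbrs O (hos O hO)).2 N).1 hN) (liftFDs_mono hF₀) ?_ ?_ hirr⟩
  · exact fun φ hφ => hred.infers ((infers_closureGraph_of_mem hG hφ).mono Set.subset_union_left)
  · exact fun φ hφ => closureGraph_fds_lhs_nonempty hG hF φ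
      (Set.union_subset_union_left _ hred.fds_subset hφ)
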